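/- Let $f,g:\mathbb{N}\to\mathbb{C}$ be arithmetic functions with $f(n)=\sum_{d\mid n}g(d)$ for all $n\ge 1$, and for real $x\ge 1$ put $$S_f(x)=\sum_{1\le n\le x} f\!\left(\left\lfloor \frac{x}{n}\right\rfloor\right),\qquad C_f=\sum_{n=1}^\infty \frac{f(n)}{n(n+1)}.$$ Let $\alpha\in[0,1)$, $\theta\ge 0$ and $K$ be real numbers such that $$\sum_{d\le x}|g(d)|\le K\,x^{\alpha}(\log x)^{\theta}\qquad\text{for all real } x\ge 2 .$$ Then the series $C_f$ converges absolutely, and $$\left|S_f(x)-C_f\,x\right|\le C\,K\,x^{\frac{1+\alpha}{3-\alpha}}(\log x)^{\theta'}\qquad\text{for all real } x\ge x_0,$$ where $\theta'=\theta$ if $\alpha>0$ and $\theta'=\max(1,\theta)$ if $\alpha=0$. Here the constant $C>0$ depends only on $\alpha$, and the threshold $x_0\ge 2$ depends only on $\alpha$ and $\theta$. -/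

import Mathlib

/-- The fractional sum `S_f(x) = ∑_{1 ≤ n ≤ x} f(⌊x/n⌋)` of an arithmetic function `f`. -/
noncomputable def fracSum (f : ArithmeticFunction ℂ) (x : ℝ) : ℂ :=
  ∑ n ∈ Finset.Icc 1 ⌊x⌋₊, f ⌊x / (n : ℝ)⌋₊

/-- The `n`-th term `f(n) / (n(n+1))` of the series defining `C_f`.
The term at `n = 0` vanishes, since `f 0 = 0` for every arithmetic function. -/
noncomputable def fracTerm (f : ArithmeticFunction ℂ) (n : ℕ) : ℂ :=
  f n / ((n : ℂ) * ((n : ℂ) + 1))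

/-- The constant `C_f = ∑_{n ≥ 1} f(n) / (n(n+1))`. -/
noncomputable def fracConst (f : ArithmeticFunction ℂ) : ℂ :=
  ∑' n : ℕ, fracTerm f n

/-- The power of `log x` in the error term: `θ`, replaced by `max(1, θ)` when `α = 0`. -/
noncomputable def logExponent (α θ : ℝ) : ℝ :=
  open Classical in if α = 0 then max 1 θ else θ

/-! Group the `k ≤ x` by `n = ⌊x/k⌋` and cut at `N = ⌊x^β⌋`, `β = 2/(3-α)`.

Since every divisor of `n` is at most `n`, the hypothesis gives `|f(n)| ≤ K n^α (log n)^θ`. So the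
terms with `⌊x/k⌋ > N`, for which `k ≤ x/N`, contribute `O(K x N^(α-1) (log x)^θ)`, and so does `x`
times the tail of `C_f` beyond `N`. For `n ≤ N` the value `n` is taken by exactly `⌊x/n⌋ -
⌊x/(n+1)⌋` integers `k`. The smooth part of this count yields `x f(n)/(n(n+1))`; what remains is a
sum of `f(n)(ψ(x/n) - ψ(x/(n+1)))` with `ψ` the sawtooth (`fracSum_eq`, `norm_fracSum_sub_le`).

Writing `n = dm` and `y = x/d`, that sum becomes `∑ g(d)` times sums of `ψ(y/m)` and `ψ(y/(m+1/d))`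
over `m ≤ N/d`. Kusmin–Landau and van der Corput's second derivative test bound the associated
exponential sums, and a Fourier argument turns this into `O(y^(1/3) log M + M²/y)` for `M ≥ 2`
(`abs_sum_sawtooth_div_le`).

Summing over `d` leaves `(N²/x) ∑ |g(d)|/d` and `x^(1/3) log x ∑ |g(d)| d^(-1/3)`. The first is of
order `K (N²/x)(log x)^θ`, and `N²/x = x N^(α-1)` is what fixes `β` and the exponent `(1+α)/(3-α)`.
The second is smaller by a power of `x` when `α > 0`. When `α = 0` both have order `x^(1/3)` up to
logarithms, and the factor `log x` explains `max(1, θ)` (`eventually_log_mul_sum_le`). -/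

open Finset Filter

/-! ### Exponential sums: Kusmin–Landau and van der Corput. -/

/-- The additive character `e(t) = exp(2πit)`. -/
noncomputable def unitExp (t : ℝ) : ℂ := Complex.exp ((2 * Real.pi * t : ℝ) * Complex.I)

lemma norm_unitExp (t : ℝ) : ‖unitExp t‖ = 1 := Complex.norm_exp_ofReal_mul_I _

lemma unitExp_add (s t : ℝ) : unitExp (s + t) = unitExp s * unitExp t := by
  simp only [unitExp]
  rw [← Complex.exp_add]
  congr 1
  push_cast
  ring

lemma unitExp_sub_int (t : ℝ) (k : ℤ) : unitExp (t - k) = unitExp t := by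
  simp only [unitExp]
  rw [Complex.exp_eq_exp_iff_exists_int]
  refine ⟨-k, ?_⟩
  push_cast
  ring

lemma unitExp_eq (t : ℝ) :
    unitExp t = (Real.cos (2 * Real.pi * t) : ℂ) + (Real.sin (2 * Real.pi * t) : ℂ) * Complex.I := by
  rw [unitExp, Complex.exp_mul_I, Complex.ofReal_cos, Complex.ofReal_sin]

lemma unitExp_sub_one (t : ℝ) :
    unitExp t - 1 = ((2 * Real.sin (Real.pi * t) : ℝ) : ℂ) * (Complex.I *
      ((Real.cos (Real.pi * t) : ℂ) + (Real.sin (Real.pi * t) : ℂ) * Complex.I)) := by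
  have h2 : 2 * Real.pi * t = 2 * (Real.pi * t) := by ring
  rw [unitExp_eq, h2, Real.cos_two_mul, Real.sin_two_mul]
  have hs : (Real.sin (Real.pi * t) : ℂ) ^ 2 + (Real.cos (Real.pi * t) : ℂ) ^ 2 = 1 := by
    exact_mod_cast Real.sin_sq_add_cos_sq (Real.pi * t)
  push_cast at hs ⊢
  linear_combination 2 * hs - 2 * Complex.sin (Real.pi * t) ^ 2 * Complex.I_sq

lemma norm_unitExp_sub_one (t : ℝ) : ‖unitExp t - 1‖ = 2 * |Real.sin (Real.pi * t)| := by
  have h2 : (Real.cos (Real.pi * t) : ℂ) + (Real.sin (Real.pi * t) : ℂ) * Complex.I =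
      unitExp (t / 2) := by
    rw [unitExp_eq, show 2 * Real.pi * (t / 2) = Real.pi * t by ring]
  rw [unitExp_sub_one, h2, norm_mul, norm_mul, norm_unitExp, Complex.norm_I, Complex.norm_real,
    Real.norm_eq_abs, abs_mul, abs_two, mul_one, mul_one]

/-- The point is the shape of `1/(e(t) - 1)`: its real part is constant and its imaginary part,
`-cot(πt)/2`, is monotone on `(0,1)`. -/
lemma inv_unitExp_sub_one (t : ℝ) (h : Real.sin (Real.pi * t) ≠ 0) :
    (-(1 / 2 : ℂ) - ((Real.cos (Real.pi * t) / (2 * Real.sin (Real.pi * t)) : ℝ) : ℂ) * Complex.I) *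
      (unitExp t - 1) = 1 := by
  rw [unitExp_sub_one]
  have hs : (Real.sin (Real.pi * t) : ℂ) ^ 2 + (Real.cos (Real.pi * t) : ℂ) ^ 2 = 1 := by
    exact_mod_cast Real.sin_sq_add_cos_sq (Real.pi * t)
  have h0 : (Real.sin (Real.pi * t) : ℂ) ≠ 0 := Complex.ofReal_ne_zero.2 h
  rw [Complex.ofReal_div, Complex.ofReal_mul, Complex.ofReal_ofNat]
  generalize (Real.sin (Real.pi * t) : ℂ) = s at *
  generalize (Real.cos (Real.pi * t) : ℂ) = c at *
  field_simp
  linear_combination hs - (c ^ 2 + s ^ 2) * Complex.I_sq - c * s * Complex.I * Complex.I_sq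

lemma two_mul_le_sin_pi_mul {t θ : ℝ} (hθ : 0 ≤ θ) (h1 : θ ≤ t) (h2 : t ≤ 1 - θ) :
    2 * θ ≤ Real.sin (Real.pi * t) := by
  have hpi := Real.pi_pos
  rcases le_total t (1 / 2) with h | h
  · have := Real.mul_le_sin (x := Real.pi * t) (mul_nonneg hpi.le (hθ.trans h1)) (by nlinarith)
    have e : 2 / Real.pi * (Real.pi * t) = 2 * t := by field_simp
    linarith
  · have := Real.mul_le_sin (x := Real.pi * (1 - t)) (by apply mul_nonneg <;> linarith) (by nlinarith)
    have e : 2 / Real.pi * (Real.pi * (1 - t)) = 2 * (1 - t) := by field_simp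
    have e2 : Real.sin (Real.pi * (1 - t)) = Real.sin (Real.pi * t) := by
      rw [mul_sub, mul_one, Real.sin_pi_sub]
    linarith

/-- Write `e(a_j) = c_j (e(a_{j+1}) - e(a_j))` with `c_j = 1/(e(d_j) - 1)` and sum by parts. The
`c_j` differ only in their imaginary parts, which are monotone, so their total variation telescopes.
-/
lemma kusmin_landau_zero (a d : ℕ → ℝ) (had : ∀ j, a (j + 1) = a j + d j) {θ : ℝ} (hθ : 0 < θ)
    (n : ℕ) (hmono : ∀ j < n, d j ≤ d (j + 1)) (hd : ∀ j ≤ n, θ ≤ d j ∧ d j ≤ 1 - θ) :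
    ‖∑ j ∈ range (n + 1), unitExp (a j)‖ ≤ 1 / θ := by
  set t : ℕ → ℝ := fun j => Real.cos (Real.pi * d j) / (2 * Real.sin (Real.pi * d j)) with ht
  set c : ℕ → ℂ := fun j => -(1 / 2 : ℂ) - (t j : ℂ) * Complex.I with hc
  have hsin : ∀ j ≤ n, 2 * θ ≤ Real.sin (Real.pi * d j) := fun j hj =>
    two_mul_le_sin_pi_mul hθ.le (hd j hj).1 (hd j hj).2
  have hsin0 : ∀ j ≤ n, 0 < Real.sin (Real.pi * d j) := fun j hj => by
    linarith [hsin j hj]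
  have hu : ∀ j ≤ n, unitExp (a j) = c j * unitExp (a (j + 1)) - c j * unitExp (a j) := by
    intro j hj
    rw [had, unitExp_add]
    have := inv_unitExp_sub_one (d j) (hsin0 j hj).ne'
    linear_combination (-unitExp (a j)) * this
  have ht_abs : ∀ j ≤ n, |t j| ≤ 1 / (4 * θ) := by
    intro j hj
    have h0 := hsin0 j hj
    simp only [ht]
    rw [abs_div, abs_of_pos (by positivity : 0 < 2 * Real.sin (Real.pi * d j))]
    exact div_le_div₀ zero_le_one (Real.abs_cos_le_one _) (by positivity)
      (by linarith [hsin j hj])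
  have hc_norm : ∀ j ≤ n, ‖c j‖ ≤ 1 / (4 * θ) := by
    intro j hj
    have h0 := hsin0 j hj
    have h1 := inv_unitExp_sub_one (d j) h0.ne'
    have h2 : ‖unitExp (d j) - 1‖ = 2 * Real.sin (Real.pi * d j) := by
      rw [norm_unitExp_sub_one, abs_of_pos h0]
    have h4 : ‖c j‖ * (2 * Real.sin (Real.pi * d j)) = 1 := by
      rw [← h2, ← norm_mul]
      simp only [hc, ht]
      rw [h1, norm_one]
    rw [eq_div_of_mul_eq (by positivity) h4]
    exact div_le_div_of_nonneg_left zero_le_one (by positivity) (by linarith [hsin j hj])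
  have hanti : ∀ j < n, t (j + 1) ≤ t j := by
    intro j hj
    have h0 := hsin0 j hj.le
    have h1 := hsin0 (j + 1) hj
    simp only [ht]
    rw [div_le_div_iff₀ (by positivity) (by positivity)]
    have h2 : 0 ≤ Real.sin (Real.pi * d (j + 1) - Real.pi * d j) := by
      have hpi := Real.pi_pos
      apply Real.sin_nonneg_of_nonneg_of_le_pi
      · nlinarith [hmono j hj]
      · nlinarith [(hd j hj.le).1, (hd (j + 1) hj).2]
    rw [Real.sin_sub] at h2
    linarith
  have key : ∀ m ≤ n, ‖∑ j ∈ range (m + 1), unitExp (a j) - c m * unitExp (a (m + 1)) +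
      c 0 * unitExp (a 0)‖ ≤ t 0 - t m := by
    intro m
    induction m with
    | zero =>
      intro _
      have := hu 0 (Nat.zero_le _)
      rw [sum_range_one, sub_self]
      refine le_of_eq (norm_eq_zero.2 ?_)
      linear_combination this
    | succ m ih =>
      intro hm
      have h1 := ih (by omega)
      rw [sum_range_succ]
      have h2 := hu (m + 1) hm
      have h3 : ∑ j ∈ range (m + 1), unitExp (a j) + unitExp (a (m + 1)) -
          c (m + 1) * unitExp (a (m + 1 + 1)) + c 0 * unitExp (a 0) =
          (∑ j ∈ range (m + 1), unitExp (a j) - c m * unitExp (a (m + 1)) +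
            c 0 * unitExp (a 0)) + (c m - c (m + 1)) * unitExp (a (m + 1)) := by
        linear_combination h2
      rw [h3]
      refine (norm_add_le _ _).trans ?_
      rw [norm_mul, norm_unitExp, mul_one]
      have h4 : c m - c (m + 1) = ((t (m + 1) - t m : ℝ) : ℂ) * Complex.I := by
        simp only [hc]
        push_cast
        ring
      rw [h4, norm_mul, Complex.norm_I, mul_one, Complex.norm_real, Real.norm_eq_abs,
        abs_of_nonpos (by linarith [hanti m (by omega)])]
      linarith
  have h1 := key n le_rfl
  have h2 : ∑ j ∈ range (n + 1), unitExp (a j) = (∑ j ∈ range (n + 1), unitExp (a j) -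
      c n * unitExp (a (n + 1)) + c 0 * unitExp (a 0)) + c n * unitExp (a (n + 1)) -
      c 0 * unitExp (a 0) := by ring
  rw [h2]
  refine (norm_sub_le _ _).trans ((add_le_add_left (norm_add_le _ _) _).trans ?_)
  rw [norm_mul, norm_mul, norm_unitExp, norm_unitExp, mul_one, mul_one]
  have h3 := hc_norm n le_rfl
  have h4 := hc_norm 0 (Nat.zero_le _)
  have h5 := abs_le.1 (ht_abs n le_rfl)
  have h6 := abs_le.1 (ht_abs 0 (Nat.zero_le _))
  -- The two boundary terms and the variation `t 0 - t n` amount to four quantities of size at most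
  -- `1/(4θ)`.
  have e : 1 / θ = 4 * (1 / (4 * θ)) := by field_simp
  linarith [h5.1, h6.2]

/-- The Kusmin–Landau inequality for a sequence whose differences `d` are nondecreasing and stay at
distance at least `θ` from the integers. -/
lemma kusmin_landau (a d : ℕ → ℝ) (had : ∀ j, a (j + 1) = a j + d j) {θ : ℝ} (hθ : 0 < θ)
    (A B : ℕ) (k : ℤ) (hmono : ∀ j, A ≤ j → j + 1 < B → d j ≤ d (j + 1))
    (hd : ∀ j, A ≤ j → j < B → k + θ ≤ d j ∧ d j ≤ k + 1 - θ) :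
    ‖∑ j ∈ Ico A B, unitExp (a j)‖ ≤ 1 / θ := by
  rcases le_or_gt B A with h | h
  · rw [Ico_eq_empty (by omega), sum_empty, norm_zero]
    positivity
  obtain ⟨n, rfl⟩ : ∃ n, B = A + (n + 1) := ⟨B - A - 1, by omega⟩
  rw [sum_Ico_eq_sum_range]
  have e : A + (n + 1) - A = n + 1 := by omega
  rw [e]
  -- Subtracting `k * j` from the phase leaves `e` unchanged and moves the differences into `[θ,
  -- 1-θ]`.
  have h1 := kusmin_landau_zero (fun j => a (A + j) - ((k * j : ℤ) : ℝ)) (fun j => d (A + j) - k)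
    (by
      intro j
      have := had (A + j)
      rw [← add_assoc, this]
      push_cast
      ring) hθ n
    (by
      intro j hj
      have := hmono (A + j) (by omega) (by omega)
      rw [← add_assoc]
      linarith)
    (by
      intro j hj
      have := hd (A + j) (by omega) (by omega)
      constructor <;> linarith [this.1, this.2])
  simpa only [unitExp_sub_int] using h1

lemma mul_sub_le_of_step (d : ℕ → ℝ) {lam : ℝ} {A B : ℕ}
    (hlam : ∀ j, A ≤ j → j + 1 < B → lam ≤ d (j + 1) - d j) (i n : ℕ) (hi : A ≤ i)
    (hn : i + n < B) : lam * n ≤ d (i + n) - d i := by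
  induction n with
  | zero => simp
  | succ n ih =>
    have h1 := ih (by omega)
    have h2 := hlam (i + n) (by omega) (by omega)
    rw [← add_assoc]
    push_cast
    linarith

/-- Steps of size at least `lam` prevent more than `w / lam + 1` of the values from falling in a
window of width `w`. -/
lemma card_le_of_step (d : ℕ → ℝ) {lam w u : ℝ} (hl : 0 < lam) (hw : 0 ≤ w) {A B : ℕ}
    (hlam : ∀ j, A ≤ j → j + 1 < B → lam ≤ d (j + 1) - d j) (s : Finset ℕ)
    (hs : s ⊆ Ico A B) (hu : ∀ j ∈ s, u ≤ d j ∧ d j ≤ u + w) : (s.card : ℝ) ≤ w / lam + 1 := by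
  rcases s.eq_empty_or_nonempty with rfl | hne
  · simp
    positivity
  have h1 := s.min'_mem hne
  have h2 := s.max'_mem hne
  have hle : s.min' hne ≤ s.max' hne := s.min'_le _ h2
  have hsub : s ⊆ Icc (s.min' hne) (s.max' hne) := fun j hj =>
    mem_Icc.2 ⟨s.min'_le _ hj, s.le_max' _ hj⟩
  have hcard := card_le_card hsub
  rw [Nat.card_Icc] at hcard
  obtain ⟨n, hn⟩ := Nat.exists_eq_add_of_le hle
  have h3 := mem_Ico.1 (hs h1)
  have h4 := mem_Ico.1 (hs h2)
  have h5 := mul_sub_le_of_step d hlam (s.min' hne) n h3.1 (by omega)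
  rw [← hn] at h5
  have h6 : (n : ℝ) ≤ w / lam := by
    rw [le_div_iff₀ hl]
    linarith [(hu _ h1).1, (hu _ h2).2]
  have h7 : s.card ≤ n + 1 := by omega
  have h8 : (s.card : ℝ) ≤ n + 1 := by exact_mod_cast h7
  linarith

lemma norm_sum_unitExp_le_card (a : ℕ → ℝ) (s : Finset ℕ) :
    ‖∑ j ∈ s, unitExp (a j)‖ ≤ s.card := by
  refine (norm_sum_le _ _).trans ?_
  simp [norm_unitExp]

/-- Van der Corput's second derivative test, in terms of differences `d` that increase by at least
`lam` at each step and by at most `V` in total. -/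
lemma van_der_corput (a d : ℕ → ℝ) (had : ∀ j, a (j + 1) = a j + d j) {lam V : ℝ} (hl : 0 < lam)
    (hl' : lam ≤ 1 / 4) {A B : ℕ} (hlam : ∀ j, A ≤ j → j + 1 < B → lam ≤ d (j + 1) - d j)
    (u : ℝ) (hV : ∀ j, A ≤ j → j < B → u ≤ d j ∧ d j ≤ u + V) (hV0 : 0 ≤ V) :
    ‖∑ j ∈ Ico A B, unitExp (a j)‖ ≤ 4 * (V + 2) / √lam := by
  set θ := √lam with hθdef
  have hθ : 0 < θ := Real.sqrt_pos.2 hl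
  have hθ2 : θ ^ 2 = lam := Real.sq_sqrt hl.le
  have hθh : θ ≤ 1 / 2 := by nlinarith
  have hmono : ∀ i j, A ≤ i → i ≤ j → j < B → d i ≤ d j := by
    intro i j hi hij hj
    obtain ⟨n, rfl⟩ := Nat.exists_eq_add_of_le hij
    have := mul_sub_le_of_step d hlam i n hi hj
    have : 0 ≤ lam * n := by positivity
    linarith
  have hmaps : ∀ j ∈ Ico A B, ⌊d j⌋ ∈ Icc ⌊u⌋ ⌊u + V⌋ := by
    intro j hj
    have hj := mem_Ico.1 hj
    have := hV j hj.1 hj.2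
    exact mem_Icc.2 ⟨Int.floor_mono this.1, Int.floor_mono this.2⟩
  -- Split by the integer part of `d j`. In each unit interval the values within `√lam` of an
  -- endpoint are few and counted trivially; the rest form an interval of indices to which
  -- Kusmin–Landau applies. Cost per interval: `(3/2 + 3/2 + 1)/θ`.
  rw [← sum_fiberwise_of_maps_to hmaps]
  have hfib : ∀ k ∈ Icc ⌊u⌋ ⌊u + V⌋, ‖∑ j ∈ Ico A B with ⌊d j⌋ = k, unitExp (a j)‖ ≤ 4 / θ := by
    intro k _
    set s := {j ∈ Ico A B | ⌊d j⌋ = k}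
    have hs : ∀ j ∈ s, (A ≤ j ∧ j < B) ∧ (k : ℝ) ≤ d j ∧ d j < k + 1 := by
      intro j hj
      have hj := mem_filter.1 hj
      exact ⟨mem_Ico.1 hj.1, Int.floor_eq_iff.1 hj.2⟩
    have hw : θ / lam + 1 ≤ 3 / 2 / θ := by
      rw [← hθ2, le_div_iff₀ hθ]
      field_simp
      linarith
    have h1 : ‖∑ j ∈ s with d j < k + θ, unitExp (a j)‖ ≤ 3 / 2 / θ := by
      refine (norm_sum_unitExp_le_card _ _).trans (le_trans ?_ hw)
      refine card_le_of_step d (u := k) hl hθ.le hlam _ ((filter_subset _ _).trans (filter_subset _ _)) ?_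
      intro j hj
      have hj := mem_filter.1 hj
      exact ⟨(hs j hj.1).2.1, hj.2.le⟩
    have h2 : ‖∑ j ∈ s with ¬ d j < k + θ, unitExp (a j)‖ ≤ 5 / 2 / θ := by
      rw [← sum_filter_add_sum_filter_not _ (fun j => d j ≤ k + 1 - θ)]
      refine (norm_add_le _ _).trans ?_
      have h3 : ‖∑ j ∈ {j ∈ s | ¬ d j < k + θ} with ¬ d j ≤ k + 1 - θ, unitExp (a j)‖ ≤
          3 / 2 / θ := by
        refine (norm_sum_unitExp_le_card _ _).trans (le_trans ?_ hw)
        refine card_le_of_step d (u := k + 1 - θ) hl hθ.le hlam _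
          (((filter_subset _ _).trans (filter_subset _ _)).trans (filter_subset _ _)) ?_
        intro j hj
        have hj := mem_filter.1 hj
        have hj' := mem_filter.1 hj.1
        exact ⟨(not_le.1 hj.2).le, by linarith [(hs j hj'.1).2.2]⟩
      have h4 : ‖∑ j ∈ {j ∈ s | ¬ d j < k + θ} with d j ≤ k + 1 - θ, unitExp (a j)‖ ≤
          1 / θ := by
        set r := {j ∈ {j ∈ s | ¬ d j < k + θ} | d j ≤ k + 1 - θ} with hr
        have hmem : ∀ j, j ∈ r ↔ (A ≤ j ∧ j < B) ∧ k + θ ≤ d j ∧ d j ≤ k + 1 - θ := by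
          intro j
          constructor
          · intro hj
            have hj := mem_filter.1 hj
            have hj' := mem_filter.1 hj.1
            exact ⟨(hs j hj'.1).1, not_lt.1 hj'.2, hj.2⟩
          · rintro ⟨hj, h5, h6⟩
            refine mem_filter.2 ⟨mem_filter.2 ⟨mem_filter.2 ⟨mem_Ico.2 hj, ?_⟩, not_lt.2 h5⟩, h6⟩
            exact Int.floor_eq_iff.2 ⟨by linarith, by linarith⟩
        rcases r.eq_empty_or_nonempty with he | hne
        · rw [he, sum_empty, norm_zero]
          positivity
        have hmin := (hmem _).1 (r.min'_mem hne)
        have hmax := (hmem _).1 (r.max'_mem hne)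
        have hrI : r = Ico (r.min' hne) (r.max' hne + 1) := by
          ext j
          rw [mem_Ico]
          constructor
          · intro hj
            exact ⟨r.min'_le _ hj, Nat.lt_succ_of_le (r.le_max' _ hj)⟩
          · rintro ⟨h5, h6⟩
            have h6 := Nat.lt_succ_iff.1 h6
            refine (hmem j).2 ⟨⟨hmin.1.1.trans h5, h6.trans_lt hmax.1.2⟩, ?_, ?_⟩
            · exact hmin.2.1.trans (hmono _ _ hmin.1.1 h5 (h6.trans_lt hmax.1.2))
            · exact (hmono _ _ (hmin.1.1.trans h5) h6 hmax.1.2).trans hmax.2.2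
        have hmem' := hmem
        rw [hrI] at hmem' ⊢
        refine kusmin_landau a d had hθ _ _ k ?_ ?_
        · intro j h5 h6
          exact hmono _ _ (hmin.1.1.trans h5) (Nat.le_succ j) (by have := hmax.1.2; omega)
        · intro j h5 h6
          exact ((hmem' j).1 (mem_Ico.2 ⟨h5, h6⟩)).2
      have e : 5 / 2 / θ = 1 / θ + 3 / 2 / θ := by ring
      rw [e]
      exact add_le_add h4 h3
    rw [← sum_filter_add_sum_filter_not _ (fun j => d j < k + θ)]
    refine (norm_add_le _ _).trans ?_
    have e : 4 / θ = 3 / 2 / θ + 5 / 2 / θ := by ring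
    rw [e]
    exact add_le_add h1 h2
  refine (norm_sum_le _ _).trans ((sum_le_card_nsmul _ _ _ hfib).trans ?_)
  rw [nsmul_eq_mul, Int.card_Icc]
  have hcard : (((⌊u + V⌋ + 1 - ⌊u⌋).toNat : ℕ) : ℝ) ≤ V + 2 := by
    have h0 : 0 ≤ ⌊u + V⌋ + 1 - ⌊u⌋ := by
      have := Int.floor_mono (by linarith : u ≤ u + V)
      omega
    have h1 : (((⌊u + V⌋ + 1 - ⌊u⌋).toNat : ℕ) : ℝ) = ((⌊u + V⌋ + 1 - ⌊u⌋ : ℤ) : ℝ) := by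
      exact_mod_cast congrArg (Int.cast (R := ℝ)) (Int.toNat_of_nonneg h0)
    rw [h1]
    push_cast
    linarith [Int.floor_le (u + V), Int.lt_floor_add_one u]
  calc _ ≤ (V + 2) * (4 / θ) := by gcongr
    _ = _ := by ring

/-! ### Sawtooth sums from exponential sums. -/

/-- The sawtooth function `ψ(t) = {t} - 1/2`. -/
noncomputable def sawtooth (t : ℝ) : ℝ := Int.fract t - 1 / 2

/-- The periodic second Bernoulli function `{t}² - {t} + 1/6`. -/
noncomputable def bernoulliTwo (t : ℝ) : ℝ := Int.fract t ^ 2 - Int.fract t + 1 / 6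

lemma abs_sawtooth_le (t : ℝ) : |sawtooth t| ≤ 1 / 2 := by
  rw [sawtooth, abs_le]
  constructor <;> linarith [Int.fract_nonneg t, Int.fract_lt_one t]

lemma hasSum_bernoulliTwo (t : ℝ) :
    HasSum (fun n : ℕ => 1 / (n : ℝ) ^ 2 * Real.cos (2 * Real.pi * (n * t)))
      (Real.pi ^ 2 * bernoulliTwo t) := by
  have h := hasSum_one_div_nat_pow_mul_cos one_ne_zero
    (x := Int.fract t) ⟨Int.fract_nonneg t, (Int.fract_lt_one t).le⟩
  have e : (Polynomial.map (algebraMap ℚ ℝ) (Polynomial.bernoulli (2 * 1))).eval (Int.fract t) =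
      bernoulliTwo t := by
    have hb : bernoulli 2 = 1 / 6 := by
      rw [bernoulli_eq_bernoulli'_of_ne_one (by norm_num), bernoulli'_two]
    simp only [Polynomial.bernoulli, Nat.reduceMul, sum_range_succ, range_one, sum_singleton,
      Polynomial.map_add, Polynomial.map_monomial, Polynomial.eval_add, Polynomial.eval_monomial,
      bernoulli_zero, bernoulli_one, hb, bernoulliTwo]
    norm_num [Nat.choose]
    ring
  rw [e] at h
  convert h using 1
  · ext n
    rw [mul_one]
    congr 1
    have : 2 * Real.pi * n * Int.fract t =
        2 * Real.pi * (n * t) - ((n * ⌊t⌋ : ℤ) : ℝ) * (2 * Real.pi) := by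
      rw [Int.fract]
      push_cast
      ring
    rw [this, Real.cos_sub_int_mul_two_pi]
  · norm_num [Nat.factorial]
    left
    ring

/-- The function `bernoulliTwo` is a primitive of `2ψ`, and `ψ` has slope 1 and only downward jumps,
so `ψ(t+u) ≤ ψ(t)+u` for `u ≥ 0`. Difference quotients of a function with absolutely convergent
Fourier series thus bound `ψ` from one side; the next lemma gives the other. -/
lemma bernoulliTwo_add_sub_le {δ : ℝ} (h0 : 0 ≤ δ) (h1 : δ ≤ 1) (t : ℝ) :
    bernoulliTwo (t + δ) - bernoulliTwo t ≤ 2 * δ * sawtooth t + δ ^ 2 := by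
  have hf0 := Int.fract_nonneg t
  have hf1 := Int.fract_lt_one t
  have ht := Int.self_sub_floor t
  simp only [bernoulliTwo, sawtooth]
  rcases lt_or_ge (Int.fract t + δ) 1 with h | h
  · have : Int.fract (t + δ) = Int.fract t + δ :=
      Int.fract_eq_iff.2 ⟨by linarith, h, ⌊t⌋, by linarith⟩
    rw [this]
    nlinarith
  · have : Int.fract (t + δ) = Int.fract t + δ - 1 :=
      Int.fract_eq_iff.2 ⟨by linarith, by linarith, ⌊t⌋ + 1, by push_cast; linarith⟩
    rw [this]
    nlinarith

lemma le_bernoulliTwo_sub_sub {δ : ℝ} (h0 : 0 ≤ δ) (h1 : δ ≤ 1) (t : ℝ) :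
    2 * δ * sawtooth t - δ ^ 2 ≤ bernoulliTwo t - bernoulliTwo (t + -δ) := by
  have hf0 := Int.fract_nonneg t
  have hf1 := Int.fract_lt_one t
  have ht := Int.self_sub_floor t
  simp only [bernoulliTwo, sawtooth]
  rcases le_or_gt δ (Int.fract t) with h | h
  · have : Int.fract (t + -δ) = Int.fract t - δ :=
      Int.fract_eq_iff.2 ⟨by linarith, by linarith, ⌊t⌋, by linarith⟩
    rw [this]
    nlinarith
  · have : Int.fract (t + -δ) = Int.fract t - δ + 1 :=
      Int.fract_eq_iff.2 ⟨by linarith, by linarith, ⌊t⌋ - 1, by push_cast; linarith⟩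
    rw [this]
    nlinarith

lemma sum_min_mul_sqrt_le_of_le {H : ℕ} (m : ℕ) (hm : m ≤ H) :
    ∑ n ∈ range (m + 1), min (1 / (n : ℝ)) (H / (n : ℝ) ^ 2) * √n ≤ 2 * √m := by
  induction m with
  | zero => simp
  | succ m ih =>
    rw [sum_range_succ]
    have h1 := ih (by omega)
    set a := √((m + 1 : ℕ) : ℝ) with ha
    set b := √(m : ℝ) with hb
    have ha2 : a ^ 2 = m + 1 := by rw [ha, Real.sq_sqrt (by positivity)]; push_cast; ring
    have hb2 : b ^ 2 = m := by rw [hb, Real.sq_sqrt (by positivity)]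
    have ha0 : 0 < a := Real.sqrt_pos.2 (by positivity)
    have h2 : min (1 / ((m + 1 : ℕ) : ℝ)) (H / ((m + 1 : ℕ) : ℝ) ^ 2) * a ≤ 1 / a := by
      have e : 1 / a = 1 / ((m + 1 : ℕ) : ℝ) * a := by
        push_cast
        rw [← ha2]
        field_simp
      rw [e]
      gcongr
      exact min_le_left _ _
    have h3 : 1 / a ≤ 2 * (a - b) := by
      rw [div_le_iff₀ ha0]
      nlinarith [sq_nonneg (a - b)]
    linarith

lemma sum_min_mul_sqrt_le {H : ℕ} (hH : 1 ≤ H) (m : ℕ) :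
    ∑ n ∈ range (m + 1), min (1 / (n : ℝ)) (H / (n : ℝ) ^ 2) * √n ≤ 4 * √H := by
  rcases le_total m H with hm | hm
  · refine (sum_min_mul_sqrt_le_of_le m hm).trans ?_
    have : √(m : ℝ) ≤ √H := Real.sqrt_le_sqrt (by exact_mod_cast hm)
    linarith [Real.sqrt_nonneg (H : ℝ)]
  -- Beyond `H` the terms are at most `H n^(-3/2)`, whose sum telescopes against `2H/√m`; at `m = H`
  -- the bound equals `2√H`.
  have key : ∑ n ∈ range (m + 1), min (1 / (n : ℝ)) (H / (n : ℝ) ^ 2) * √n ≤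
      4 * √H - 2 * H / √m := by
    induction m, hm using Nat.le_induction with
    | base =>
      have h1 := sum_min_mul_sqrt_le_of_le H le_rfl
      have h2 : 2 * (H : ℝ) / √H = 2 * √H := by rw [mul_div_assoc, Real.div_sqrt]
      linarith
    | succ m hm ih =>
      rw [sum_range_succ]
      have hm1 : (1 : ℝ) ≤ m := by exact_mod_cast hH.trans hm
      set a := √((m + 1 : ℕ) : ℝ) with ha
      set b := √(m : ℝ) with hb
      have ha2 : a ^ 2 = m + 1 := by rw [ha, Real.sq_sqrt (by positivity)]; push_cast; ring
      have hb2 : b ^ 2 = m := by rw [hb, Real.sq_sqrt (by positivity)]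
      have ha0 : 0 < a := Real.sqrt_pos.2 (by positivity)
      have hb0 : 0 < b := Real.sqrt_pos.2 (by positivity)
      have hba : b ≤ a := by nlinarith
      have h2 : min (1 / ((m + 1 : ℕ) : ℝ)) (H / ((m + 1 : ℕ) : ℝ) ^ 2) * a ≤ H / a ^ 3 := by
        have e : H / a ^ 3 = H / ((m + 1 : ℕ) : ℝ) ^ 2 * a := by
          push_cast
          rw [← ha2]
          field_simp
        rw [e]
        gcongr
        exact min_le_right _ _
      have h3 : H / a ^ 3 ≤ 2 * H / b - 2 * H / a := by
        have e : 2 * H / b - 2 * H / a = H * (2 * (a - b) / (b * a)) := by field_simp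
        rw [e, div_eq_mul_one_div]
        refine mul_le_mul_of_nonneg_left ?_ (Nat.cast_nonneg _)
        rw [div_le_div_iff₀ (by positivity) (by positivity)]
        have h4 : (a - b) * (a + b) = 1 := by linarith
        have h5 : 1 ≤ 2 * a * (a - b) := by nlinarith
        have h6 : a ^ 2 * 1 ≤ a ^ 2 * (2 * a * (a - b)) := by gcongr
        nlinarith
      linarith
  have : 0 ≤ 2 * (H : ℝ) / √m := by positivity
  linarith

lemma sum_inv_sq_le (m : ℕ) : ∑ n ∈ range (m + 1), 1 / (n : ℝ) ^ 2 ≤ 2 := by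
  rcases Nat.eq_zero_or_pos m with rfl | hm
  · simp
  have key : ∑ n ∈ range (m + 1), 1 / (n : ℝ) ^ 2 ≤ 2 - 1 / (m : ℝ) := by
    induction m, hm using Nat.le_induction with
    | base => norm_num [sum_range_succ]
    | succ m hm ih =>
      rw [sum_range_succ]
      have hm1 : (1 : ℝ) ≤ m := by exact_mod_cast hm
      have : 1 / ((m + 1 : ℕ) : ℝ) ^ 2 ≤ 1 / m - 1 / ((m + 1 : ℕ) : ℝ) := by
        push_cast
        rw [div_sub_div _ _ (by positivity) (by positivity), div_le_div_iff₀ (by positivity)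
          (by positivity)]
        nlinarith
      linarith
  have : 0 ≤ 1 / (m : ℝ) := by positivity
  linarith

/-- In the Fourier series the shift multiplies the `n`-th exponential sum by `e(nη) - 1`, of size
`O(min(n, H)/H)`. The minimum gains a factor `1/H` at low frequencies and keeps the series
convergent at high ones, even against `U√n`. -/
lemma abs_sum_bernoulliTwo_le {ι : Type*} (s : Finset ι) (t : ι → ℝ) {H : ℕ} (hH : 1 ≤ H)
    {U W : ℝ} (hU : 0 ≤ U) (hW : 0 ≤ W)
    (hS : ∀ h : ℕ, 1 ≤ h → ‖∑ i ∈ s, unitExp (h * t i)‖ ≤ U * √h + W / h)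
    {η : ℝ} (hη : |η| = 1 / H) :
    |∑ i ∈ s, (bernoulliTwo (t i + η) - bernoulliTwo (t i))| ≤ 2 / H * (4 * U * √H + 2 * W) := by
  have hH0 : (0 : ℝ) < H := by exact_mod_cast hH
  have hpi := Real.pi_pos
  have hsum : HasSum (fun n : ℕ => 1 / (n : ℝ) ^ 2 * ∑ i ∈ s,
      (Real.cos (2 * Real.pi * (n * (t i + η))) - Real.cos (2 * Real.pi * (n * t i))))
      (Real.pi ^ 2 * ∑ i ∈ s, (bernoulliTwo (t i + η) - bernoulliTwo (t i))) := by
    simp only [mul_sum, mul_sub]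
    exact hasSum_sum fun i _ => (hasSum_bernoulliTwo _).sub (hasSum_bernoulliTwo _)
  have hterm : ∀ n : ℕ, |1 / (n : ℝ) ^ 2 * ∑ i ∈ s,
      (Real.cos (2 * Real.pi * (n * (t i + η))) - Real.cos (2 * Real.pi * (n * t i)))| ≤
      2 * Real.pi / H * (U * (min (1 / (n : ℝ)) (H / (n : ℝ) ^ 2) * √n) +
        W * (1 / (n : ℝ) ^ 2)) := by
    intro n
    rcases Nat.eq_zero_or_pos n with rfl | hn
    · simp
    have hn0 : (0 : ℝ) < n := by exact_mod_cast hn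
    have h1 : ∑ i ∈ s, (Real.cos (2 * Real.pi * (n * (t i + η))) -
        Real.cos (2 * Real.pi * (n * t i))) =
        ((unitExp (n * η) - 1) * ∑ i ∈ s, unitExp (n * t i)).re := by
      rw [mul_sum, Complex.re_sum]
      refine sum_congr rfl fun i _ => ?_
      rw [sub_mul, one_mul, ← unitExp_add, Complex.sub_re]
      have hre : ∀ v : ℝ, (unitExp v).re = Real.cos (2 * Real.pi * v) := fun v =>
        Complex.exp_ofReal_mul_I_re _
      rw [hre, hre, mul_add (n : ℝ), add_comm ((n : ℝ) * t i)]
    have h2 : ‖unitExp (n * η) - 1‖ ≤ 2 * Real.pi / H * min (n : ℝ) H := by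
      rw [norm_unitExp_sub_one]
      have h3 : |Real.sin (Real.pi * (n * η))| ≤ 1 := Real.abs_sin_le_one _
      have h4 : |Real.sin (Real.pi * (n * η))| ≤ Real.pi * (n * (1 / H)) := by
        refine Real.abs_sin_le_abs.trans ?_
        rw [abs_mul, abs_mul, hη, abs_of_pos hpi, abs_of_pos hn0]
      rcases min_choice (n : ℝ) (H : ℝ) with h5 | h5
      · rw [h5]
        calc _ ≤ 2 * (Real.pi * (n * (1 / H))) := by gcongr
          _ = _ := by ring
      · rw [h5, div_mul_cancel₀ _ hH0.ne']
        linarith [Real.two_le_pi]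
    rw [abs_mul, h1, abs_of_pos (by positivity)]
    have h6 := (Complex.abs_re_le_norm ((unitExp (n * η) - 1) * ∑ i ∈ s, unitExp (n * t i)))
    rw [norm_mul] at h6
    have h7 : min (1 / (n : ℝ)) (H / (n : ℝ) ^ 2) = 1 / (n : ℝ) ^ 2 * min (n : ℝ) H := by
      rw [mul_min_of_nonneg _ _ (by positivity)]
      congr 1 <;> field_simp
    calc _ ≤ 1 / (n : ℝ) ^ 2 * (2 * Real.pi / H * min (n : ℝ) H * (U * √n + W / n)) := by
          gcongr
          exact h6.trans (mul_le_mul h2 (hS n hn) (norm_nonneg _) (by positivity))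
      _ = 2 * Real.pi / H * (U * (1 / (n : ℝ) ^ 2 * min (n : ℝ) H * √n) +
          W * (1 / (n : ℝ) ^ 2 * (min (n : ℝ) H / n))) := by ring
      _ ≤ _ := by
          rw [h7]
          gcongr
          refine mul_le_of_le_one_right (by positivity) ?_
          rw [div_le_one hn0]
          exact min_le_left _ _
  have hbound : |Real.pi ^ 2 * ∑ i ∈ s, (bernoulliTwo (t i + η) - bernoulliTwo (t i))| ≤
      2 * Real.pi / H * (4 * U * √H + 2 * W) := by
    have htend := ((Filter.tendsto_add_atTop_iff_nat 1).2 hsum.tendsto_sum_nat).abs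
    refine le_of_tendsto htend (Filter.Eventually.of_forall fun m => ?_)
    refine (abs_sum_le_sum_abs _ _).trans ((sum_le_sum fun n _ => hterm n).trans ?_)
    rw [← mul_sum, sum_add_distrib, ← mul_sum, ← mul_sum]
    have h1 := mul_le_mul_of_nonneg_left (sum_min_mul_sqrt_le hH m) hU
    have h2 := mul_le_mul_of_nonneg_left (sum_inv_sq_le m) hW
    refine mul_le_mul_of_nonneg_left ?_ (by positivity)
    linarith
  rw [abs_mul, abs_of_pos (by positivity)] at hbound
  have h1 : Real.pi * |∑ i ∈ s, (bernoulliTwo (t i + η) - bernoulliTwo (t i))| ≤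
      2 / H * (4 * U * √H + 2 * W) := by
    refine le_of_mul_le_mul_left (le_of_eq_of_le ?_ (hbound.trans (le_of_eq ?_))) hpi <;> ring
  nlinarith [Real.two_le_pi, abs_nonneg (∑ i ∈ s, (bernoulliTwo (t i + η) - bernoulliTwo (t i)))]

/-- A truncated Erdős–Turán type inequality for the sawtooth function. -/
lemma abs_sum_sawtooth_le {ι : Type*} (s : Finset ι) (t : ι → ℝ) {H : ℕ} (hH : 1 ≤ H)
    {U W : ℝ} (hU : 0 ≤ U) (hW : 0 ≤ W)
    (hS : ∀ h : ℕ, 1 ≤ h → ‖∑ i ∈ s, unitExp (h * t i)‖ ≤ U * √h + W / h) :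
    |∑ i ∈ s, sawtooth (t i)| ≤ s.card / H + (4 * U * √H + 2 * W) := by
  have hH0 : (0 : ℝ) < H := by exact_mod_cast hH
  have hH1 : (1 : ℝ) ≤ H := by exact_mod_cast hH
  have hδ0 : (0 : ℝ) ≤ 1 / H := by positivity
  have hδ1 : (1 : ℝ) / H ≤ 1 := by rw [div_le_one hH0]; exact hH1
  -- Both shifts are by `δ = 1/H`; dividing the two one-sided inequalities by `2δ` turns the error
  -- `δ²` per point into `1/(2H)`.
  have h1 := abs_sum_bernoulliTwo_le s t hH hU hW hS (η := 1 / H) (abs_of_nonneg hδ0)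
  have h2 := abs_sum_bernoulliTwo_le s t hH hU hW hS (η := -(1 / H))
    (by rw [abs_neg, abs_of_nonneg hδ0])
  have h3 := sum_le_sum fun i (_ : i ∈ s) => bernoulliTwo_add_sub_le hδ0 hδ1 (t i)
  have h4 := sum_le_sum fun i (_ : i ∈ s) => le_bernoulliTwo_sub_sub hδ0 hδ1 (t i)
  rw [sum_add_distrib, ← mul_sum, sum_const, nsmul_eq_mul] at h3
  rw [sum_sub_distrib, ← mul_sum, sum_const, nsmul_eq_mul] at h4
  have h5 : ∑ i ∈ s, (bernoulliTwo (t i) - bernoulliTwo (t i + -(1 / H))) =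
      -∑ i ∈ s, (bernoulliTwo (t i + -(1 / H)) - bernoulliTwo (t i)) := by
    rw [← sum_neg_distrib]
    exact sum_congr rfl fun _ _ => by ring
  rw [h5] at h4
  have h6 := (abs_le.1 h1).1
  have h7 := (abs_le.1 h2).1
  set R := 4 * U * √H + 2 * W
  have e1 : (s.card : ℝ) * (1 / H) ^ 2 = 1 / H * (s.card / H) := by ring
  have e2 : 2 / (H : ℝ) * R = 1 / H * (2 * R) := by ring
  have e3 : 2 * (1 / (H : ℝ)) * ∑ i ∈ s, sawtooth (t i) =
      1 / H * (2 * ∑ i ∈ s, sawtooth (t i)) := by ring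
  rw [e1, e3] at h3 h4
  rw [e2] at h6 h7
  have hpos : (0 : ℝ) < 1 / H := by positivity
  have h8 : 2 * ∑ i ∈ s, sawtooth (t i) ≤ s.card / H + 2 * R := by
    refine le_of_mul_le_mul_left ?_ hpos
    rw [mul_add]
    linarith
  have h9 : -(s.card / H + 2 * R) ≤ 2 * ∑ i ∈ s, sawtooth (t i) := by
    refine le_of_mul_le_mul_left ?_ hpos
    rw [mul_neg, mul_add]
    linarith
  have h10 : (0 : ℝ) ≤ s.card / H := by positivity
  rw [abs_le]
  constructor <;> linarith

/-! ### Sawtooth sums along `y/(m+κ)`. -/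

/-- On a dyadic block the phase has first differences of order `-z/A²` and second differences of
order `z/A³`. If `z/A² ≤ 1/2` the former lie in `(-1, 0)` and Kusmin–Landau applies; otherwise the
second derivative test does, unless `z/(6A³) > 1/4`, where counting terms suffices. -/
lemma norm_sum_unitExp_div_le {z κ : ℝ} (hz : 0 < z) (hκ0 : 0 ≤ κ) (hκ1 : κ ≤ 1) {A B : ℕ}
    (hA : 1 ≤ A) (hB : B ≤ 2 * A) :
    ‖∑ m ∈ Ico A B, unitExp (z / (m + κ))‖ ≤ 50 * √(z / A) + 6 * A ^ 2 / z := by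
  have hA1 : (1 : ℝ) ≤ A := by exact_mod_cast hA
  have hA0 : (0 : ℝ) < A := by linarith
  rcases Nat.eq_zero_or_pos B with rfl | hB0
  · simp
    positivity
  -- The sequence is shifted so that no denominator vanishes outside the range of summation.
  set a : ℕ → ℝ := fun m => z / (((max m 1 : ℕ) : ℝ) + κ) with ha
  have hsum : ∑ m ∈ Ico A B, unitExp (z / (m + κ)) = ∑ m ∈ Ico A B, unitExp (a m) := by
    refine sum_congr rfl fun m hm => ?_
    simp only [ha]
    rw [max_eq_left (hA.trans (mem_Ico.1 hm).1)]
  rw [hsum]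
  set d : ℕ → ℝ := fun m => a (m + 1) - a m with hd
  have had : ∀ j, a (j + 1) = a j + d j := fun j => by simp [hd]
  have hdv : ∀ j, A ≤ j → d j = -(z / ((j + κ) * (j + 1 + κ))) := by
    intro j hj
    have hj0 : (1 : ℝ) ≤ j := by exact_mod_cast hA.trans hj
    simp only [hd, ha]
    rw [max_eq_left (by omega), max_eq_left (by omega)]
    push_cast
    field_simp
    ring
  have hstep : ∀ j, A ≤ j → j + 1 < B → z / (6 * A ^ 3) ≤ d (j + 1) - d j := by
    intro j hj hjB
    have hj0 : (A : ℝ) ≤ j := by exact_mod_cast hj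
    have hjB' : (j : ℝ) + 2 ≤ 2 * A := by exact_mod_cast (by omega : j + 2 ≤ 2 * A)
    have hjp : 0 < (j : ℝ) := by linarith
    rw [hdv j hj, hdv (j + 1) (by omega)]
    have e : -(z / ((((j + 1 : ℕ) : ℝ) + κ) * (((j + 1 : ℕ) : ℝ) + 1 + κ))) -
        -(z / ((j + κ) * (j + 1 + κ))) =
        z * 2 / ((j + κ) * (j + 1 + κ) * (j + 2 + κ)) := by
      push_cast
      field_simp
      ring
    rw [e, mul_div_assoc, div_eq_mul_one_div]
    refine mul_le_mul_of_nonneg_left ?_ hz.le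
    rw [div_le_div_iff₀ (by positivity) (by positivity)]
    have : (j + κ) * (j + 1 + κ) * (j + 2 + κ) ≤ (2 * A) * (2 * A) * (3 * A) := by
      gcongr <;> linarith
    nlinarith
  have hlow : ∀ j, A ≤ j → j < B → z / (6 * A ^ 2) ≤ z / ((j + κ) * (j + 1 + κ)) := by
    intro j hj hjB
    have hj0 : (A : ℝ) ≤ j := by exact_mod_cast hj
    have hjB' : (j : ℝ) + 1 ≤ 2 * A := by exact_mod_cast (by omega : j + 1 ≤ 2 * A)
    have hjp : 0 < (j : ℝ) := by linarith
    have : (j + κ) * (j + 1 + κ) ≤ (2 * A) * (3 * A) := by gcongr <;> linarith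
    exact div_le_div_of_nonneg_left hz.le (by positivity) (by linarith)
  have hhigh : ∀ j, A ≤ j → z / ((j + κ) * (j + 1 + κ)) ≤ z / A ^ 2 := by
    intro j hj
    have hj0 : (A : ℝ) ≤ j := by exact_mod_cast hj
    gcongr
    rw [sq]
    gcongr <;> linarith
  rcases le_or_gt (z / A ^ 2) (1 / 2) with hc | hc
  · have h1 := kusmin_landau a d had (θ := z / (6 * A ^ 2)) (by positivity) A B (-1)
      (by
        intro j hj hjB
        have := hstep j hj hjB
        have : 0 ≤ z / (6 * (A : ℝ) ^ 3) := by positivity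
        linarith)
      (by
        intro j hj hjB
        have h2 := hlow j hj hjB
        have h3 := hhigh j hj
        have h4 : z / (6 * (A : ℝ) ^ 2) ≤ 1 / 2 * (z / A ^ 2) := by
          have : 0 ≤ z / (A : ℝ) ^ 2 := by positivity
          have e : z / (6 * (A : ℝ) ^ 2) = 1 / 6 * (z / A ^ 2) := by ring
          linarith
        rw [hdv j hj]
        push_cast
        constructor <;> linarith)
    refine h1.trans ?_
    rw [one_div_div]
    linarith [Real.sqrt_nonneg (z / A)]
  · have hr : 0 ≤ 6 * (A : ℝ) ^ 2 / z := by positivity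
    rcases le_or_gt (z / (6 * (A : ℝ) ^ 3)) (1 / 4) with hl | hl
    · have h1 := van_der_corput a d had (lam := z / (6 * A ^ 3)) (V := z / A ^ 2) (by positivity)
        hl hstep (-(z / A ^ 2))
        (by
          intro j hj hjB
          have h3 := hhigh j hj
          have h2 : 0 ≤ z / (((j : ℝ) + κ) * (j + 1 + κ)) := by positivity
          rw [hdv j hj]
          constructor <;> linarith) (by positivity)
      refine h1.trans ?_
      have h2 : 4 * (z / (A : ℝ) ^ 2 + 2) / √(z / (6 * A ^ 3)) ≤ 50 * √(z / A) := by
        rw [div_le_iff₀ (Real.sqrt_pos.2 (by positivity)), mul_assoc,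
          ← Real.sqrt_mul (by positivity)]
        -- Here `V = z/A² > 1/2` gives `4(V+2) ≤ 20V`, and `2/5 ≤ 1/√6`; hence the constant 50.
        have h3 : 2 / 5 * (z / (A : ℝ) ^ 2) ≤ √(z / A * (z / (6 * A ^ 3))) := by
          apply Real.le_sqrt_of_sq_le
          have e1 : z / A * (z / (6 * (A : ℝ) ^ 3)) = 1 / 6 * (z / A ^ 2) ^ 2 := by
            field_simp
          rw [e1, mul_pow]
          gcongr
          norm_num
        linarith
      linarith
    · have h1 := norm_sum_unitExp_le_card a (Ico A B)
      rw [Nat.card_Ico] at h1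
      have h2 : ((B - A : ℕ) : ℝ) ≤ A := by exact_mod_cast (by omega : B - A ≤ A)
      have h3 : (A : ℝ) ≤ √(z / A) := by
        apply Real.le_sqrt_of_sq_le
        rw [lt_div_iff₀ (by positivity)] at hl
        rw [le_div_iff₀ hA0]
        nlinarith [pow_pos hA0 3]
      linarith [Real.sqrt_nonneg (z / A)]

lemma abs_sum_sawtooth_div_dyadic_le {y κ : ℝ} (hy : 0 < y) (hκ0 : 0 ≤ κ) (hκ1 : κ ≤ 1) {A B : ℕ}
    (hA : 1 ≤ A) (hB : B ≤ 2 * A) :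
    |∑ m ∈ Ico A B, sawtooth (y / (m + κ))| ≤ 301 * (y ^ (1 / 3 : ℝ) + A ^ 2 / y) := by
  have hA1 : (1 : ℝ) ≤ A := by exact_mod_cast hA
  have hA0 : (0 : ℝ) < A := by linarith
  set r := y ^ (1 / 3 : ℝ) with hr
  have hr0 : 0 < r := Real.rpow_pos_of_pos hy _
  have hr3 : r ^ 3 = y := by
    rw [hr, ← Real.rpow_natCast, ← Real.rpow_mul hy.le]
    norm_num
  have hcard : ((Ico A B).card : ℝ) ≤ A := by
    rw [Nat.card_Ico]
    exact_mod_cast (by omega : B - A ≤ A)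
  have hq : 0 ≤ (A : ℝ) ^ 2 / y := by positivity
  rcases le_or_gt (A : ℝ) r with h | h
  · refine (abs_sum_le_sum_abs _ _).trans ((sum_le_card_nsmul _ _ _ fun m _ =>
      abs_sawtooth_le _).trans ?_)
    rw [nsmul_eq_mul]
    linarith
  -- This `H` balances the truncation error `A/H` against `√(y/A) √H`, both becoming of order
  -- `y^(1/3)`.
  set H := ⌈A / r⌉₊ with hH
  have hAr : 1 < A / r := by rwa [one_lt_div hr0]
  have hH1 : 1 ≤ H := Nat.one_le_ceil_iff.2 (by linarith)
  have hHl : A / r ≤ H := Nat.le_ceil _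
  have hHu : (H : ℝ) ≤ 2 * A / r := by
    have := Nat.ceil_lt_add_one (by linarith : 0 ≤ A / r)
    rw [mul_div_assoc]
    linarith
  have h1 := abs_sum_sawtooth_le (Ico A B) (fun m : ℕ => y / (m + κ)) hH1
    (U := 50 * √(y / A)) (W := 6 * A ^ 2 / y) (by positivity) (by positivity)
    (by
      intro n hn
      have hn0 : (0 : ℝ) < n := by exact_mod_cast hn
      have h2 := norm_sum_unitExp_div_le (z := n * y) (by positivity) hκ0 hκ1 hA hB
      simp only [← mul_div_assoc]
      refine h2.trans (le_of_eq ?_)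
      rw [mul_assoc, ← Real.sqrt_mul (by positivity)]
      congr 1
      · congr 2
        ring
      · rw [div_div, mul_comm y])
  refine h1.trans ?_
  have h2 : ((Ico A B).card : ℝ) / H ≤ r := by
    rw [div_le_iff₀ (by exact_mod_cast hH1)]
    rw [div_le_iff₀ hr0] at hHl
    linarith
  have h3 : √(y / A) * √H ≤ 3 / 2 * r := by
    rw [← Real.sqrt_mul (by positivity)]
    apply Real.sqrt_le_iff.2
    refine ⟨by positivity, ?_⟩
    calc y / A * H ≤ y / A * (2 * A / r) := by gcongr
      _ = 2 * r ^ 2 := by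
        rw [← hr3]
        field_simp
      _ ≤ _ := by nlinarith [sq_nonneg r]
  have e1 : 6 * (A : ℝ) ^ 2 / y = 6 * (A ^ 2 / y) := by ring
  rw [e1]
  nlinarith

lemma abs_sum_sawtooth_div_le {y κ : ℝ} (hy : 0 < y) (hκ0 : 0 ≤ κ) (hκ1 : κ ≤ 1) (M : ℕ) :
    |∑ m ∈ Icc 1 M, sawtooth (y / (m + κ))| ≤
      301 * (y ^ (1 / 3 : ℝ) * (Nat.log 2 M + 1) + 2 * (M ^ 2 / y)) := by
  have hr0 : 0 < y ^ (1 / 3 : ℝ) := Real.rpow_pos_of_pos hy _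
  induction M using Nat.strong_induction_on with
  | _ M ih =>
    rcases Nat.lt_or_ge M 2 with hM | hM
    · interval_cases M
      · simp
        positivity
      · have h := abs_sum_sawtooth_div_dyadic_le hy hκ0 hκ1 le_rfl (B := 2) le_rfl
        have e : Icc 1 1 = Ico 1 2 := rfl
        rw [e]
        refine h.trans ?_
        have : 0 ≤ 1 / y := by positivity
        simp
        linarith [inv_pos.2 hy]
    -- Halving `M` costs one dyadic block; the terms `M²/y` shrink by 4 each time, so only `y^(1/3)`
    -- acquires a logarithm.
    have h1 := ih (M / 2) (by omega)
    have h2 := abs_sum_sawtooth_div_dyadic_le hy hκ0 hκ1 (A := M / 2 + 1) (B := M + 1) (by omega)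
      (by omega)
    have hsplit : ∑ m ∈ Icc 1 M, sawtooth (y / (m + κ)) =
        ∑ m ∈ Icc 1 (M / 2), sawtooth (y / (m + κ)) +
        ∑ m ∈ Ico (M / 2 + 1) (M + 1), sawtooth (y / (m + κ)) := by
      have e1 : Icc 1 M = Ico 1 (M + 1) := rfl
      have e2 : Icc 1 (M / 2) = Ico 1 (M / 2 + 1) := rfl
      rw [e1, e2, sum_Ico_consecutive _ (by omega) (by omega)]
    have hlog : Nat.log 2 M = Nat.log 2 (M / 2) + 1 := by
      rw [Nat.log_of_one_lt_of_le one_lt_two hM]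
    have h3 : ((M / 2 + 1 : ℕ) : ℝ) ^ 2 / y ≤ M ^ 2 / y := by
      gcongr
      omega
    have h4 : (((M / 2 : ℕ) : ℝ)) ^ 2 / y ≤ 1 / 4 * (M ^ 2 / y) := by
      have h5 : ((M / 2 : ℕ) : ℝ) ≤ M / 2 := Nat.cast_div_le
      calc (((M / 2 : ℕ) : ℝ)) ^ 2 / y ≤ ((M : ℝ) / 2) ^ 2 / y := by gcongr
        _ = _ := by ring
    rw [hsplit, hlog]
    refine (abs_add_le _ _).trans ?_
    push_cast at *
    have h5 : 0 ≤ (M : ℝ) ^ 2 / y := by positivity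
    linarith

/-! ### Decomposition of the fractional sum. -/

lemma card_Ioc_floor_div {x : ℝ} (hx : 0 ≤ x) {n : ℕ} (hn : 1 ≤ n) :
    ((Ioc ⌊x / ((n : ℝ) + 1)⌋₊ ⌊x / (n : ℝ)⌋₊).card : ℝ) =
      (⌊x / (n : ℝ)⌋₊ : ℝ) - (⌊x / ((n : ℝ) + 1)⌋₊ : ℝ) := by
  have hn0 : (0 : ℝ) < n := by exact_mod_cast hn
  rw [Nat.card_Ioc, Nat.cast_sub]
  apply Nat.floor_mono
  gcongr
  linarith

lemma natCast_floor_eq_sub_sawtooth {t : ℝ} (ht : 0 ≤ t) :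
    (⌊t⌋₊ : ℝ) = t - 1 / 2 - sawtooth t := by
  rw [natCast_floor_eq_intCast_floor ht, sawtooth, Int.fract]
  ring

/-- Splitting `fracSum f x` according to the size of `⌊x/k⌋`. -/
lemma fracSum_eq (f : ArithmeticFunction ℂ) {x : ℝ} (hx : 0 ≤ x) (N : ℕ) :
    fracSum f x = ∑ k ∈ (Icc 1 ⌊x⌋₊).filter (fun k : ℕ => N < ⌊x / (k : ℝ)⌋₊), f ⌊x / (k : ℝ)⌋₊ +
      ∑ n ∈ Icc 1 N, f n * ((x / n - x / (n + 1) -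
        (sawtooth (x / n) - sawtooth (x / (n + 1))) : ℝ) : ℂ) := by
  rw [fracSum, ← sum_filter_add_sum_filter_not _ (fun k : ℕ => N < ⌊x / (k : ℝ)⌋₊)]
  congr 1
  have hmaps : ∀ k ∈ (Icc 1 ⌊x⌋₊).filter (fun k : ℕ => ¬ N < ⌊x / (k : ℝ)⌋₊), ⌊x / (k : ℝ)⌋₊ ∈ Icc 1 N := by
    intro k hk
    obtain ⟨hk1, hk2⟩ := mem_filter.1 hk
    obtain ⟨h1, h2⟩ := mem_Icc.1 hk1
    have hk0 : (0 : ℝ) < k := by exact_mod_cast h1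
    refine mem_Icc.2 ⟨Nat.one_le_floor_iff _ |>.2 ?_, not_lt.1 hk2⟩
    rw [one_le_div hk0]
    exact (Nat.le_floor_iff hx).1 h2
  rw [← sum_fiberwise_of_maps_to hmaps]
  refine sum_congr rfl fun n hn => ?_
  obtain ⟨hn1, hnN⟩ := mem_Icc.1 hn
  have hn0 : (0 : ℝ) < n := by exact_mod_cast hn1
  -- For positive `k`, `⌊x/k⌋ = n` means `x/(n+1) < k ≤ x/n`.
  have hset : ((Icc 1 ⌊x⌋₊).filter (fun k : ℕ => ¬ N < ⌊x / (k : ℝ)⌋₊)).filter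
      (fun k : ℕ => ⌊x / (k : ℝ)⌋₊ = n) =
      Ioc ⌊x / ((n : ℝ) + 1)⌋₊ ⌊x / (n : ℝ)⌋₊ := by
    ext k
    simp only [mem_filter, mem_Icc, mem_Ioc]
    rw [Nat.floor_lt (by positivity), Nat.le_floor_iff hx, Nat.le_floor_iff (by positivity),
      div_lt_iff₀ (by positivity), le_div_iff₀ hn0]
    constructor
    · rintro ⟨⟨⟨h1, h2⟩, h3⟩, h4⟩
      have hk0 : (0 : ℝ) < k := by exact_mod_cast h1
      rw [Nat.floor_eq_iff (by positivity), le_div_iff₀ hk0, div_lt_iff₀ hk0] at h4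
      constructor <;> linarith [h4.1, h4.2]
    · rintro ⟨h1, h2⟩
      have hk0 : (0 : ℝ) < k := by
        by_contra hcon
        have : (k : ℝ) * (n + 1) ≤ 0 := mul_nonpos_of_nonpos_of_nonneg (not_lt.1 hcon) (by positivity)
        linarith
      have h4 : ⌊x / (k : ℝ)⌋₊ = n := by
        rw [Nat.floor_eq_iff (by positivity), le_div_iff₀ hk0, div_lt_iff₀ hk0]
        constructor <;> linarith
      refine ⟨⟨⟨by exact_mod_cast hk0, ?_⟩, by omega⟩, h4⟩
      have : (1 : ℝ) ≤ n := by exact_mod_cast hn1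
      nlinarith
  rw [hset]
  have hval : ∀ k ∈ Ioc ⌊x / ((n : ℝ) + 1)⌋₊ ⌊x / (n : ℝ)⌋₊, f ⌊x / (k : ℝ)⌋₊ = f n := by
    intro k hk
    rw [← hset] at hk
    rw [(mem_filter.1 hk).2]
  rw [sum_congr rfl hval, sum_const, nsmul_eq_mul, mul_comm]
  congr 1
  rw [← Complex.ofReal_natCast]
  congr 1
  rw [card_Ioc_floor_div hx hn1,
    natCast_floor_eq_sub_sawtooth (by positivity), natCast_floor_eq_sub_sawtooth (by positivity)]
  ring

lemma sum_mul_divisorSum {f g : ArithmeticFunction ℂ}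
    (hfg : ∀ n : ℕ, 1 ≤ n → f n = ∑ d ∈ n.divisors, g d) (w : ℕ → ℂ) (N : ℕ) :
    ∑ n ∈ Icc 1 N, f n * w n = ∑ d ∈ Icc 1 N, g d * ∑ m ∈ Icc 1 (N / d), w (d * m) := by
  have h1 : ∑ n ∈ Icc 1 N, f n * w n = ∑ n ∈ Icc 1 N, ∑ d ∈ n.divisors, g d * w n :=
    sum_congr rfl fun n hn => by rw [hfg n (mem_Icc.1 hn).1, sum_mul]
  simp only [h1, mul_sum]
  rw [sum_sigma', sum_sigma']
  refine sum_bij' (fun p _ => ⟨p.2, p.1 / p.2⟩) (fun p _ => ⟨p.1 * p.2, p.1⟩) ?_ ?_ ?_ ?_ ?_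
  · rintro ⟨n, d⟩ h
    simp only [mem_sigma, mem_Icc, Nat.mem_divisors] at h ⊢
    have hd := Nat.pos_of_dvd_of_pos h.2.1 h.1.1
    have hdn := Nat.le_of_dvd h.1.1 h.2.1
    exact ⟨⟨hd, hdn.trans h.1.2⟩, Nat.div_pos hdn hd, Nat.div_le_div_right h.1.2⟩
  · rintro ⟨d, m⟩ h
    simp only [mem_sigma, mem_Icc, Nat.mem_divisors] at h ⊢
    have h2 : d * m ≤ N := by
      rw [mul_comm]
      exact (Nat.le_div_iff_mul_le h.1.1).1 h.2.2
    have h3 := Nat.mul_pos h.1.1 h.2.1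
    exact ⟨⟨h3, h2⟩, Dvd.intro _ rfl, h3.ne'⟩
  · rintro ⟨n, d⟩ h
    simp only [mem_sigma, mem_Icc, Nat.mem_divisors] at h ⊢
    rw [Nat.mul_div_cancel' h.2.1]
  · rintro ⟨d, m⟩ h
    simp only [mem_sigma, mem_Icc] at h ⊢
    rw [Nat.mul_div_cancel_left _ h.1.1]
  · rintro ⟨n, d⟩ h
    simp only [mem_sigma, mem_Icc, Nat.mem_divisors] at h ⊢
    rw [Nat.mul_div_cancel' h.2.1]

/-- With `y = x/d` one has `x/(dm) = y/m` and `x/(dm+1) = y/(m + 1/d)`: the cases `κ = 0` and `κ =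
1/d` of the sawtooth bound. -/
lemma abs_sum_sawtooth_multiples_le {x : ℝ} (hx : 0 < x) {N d : ℕ} (hd : 1 ≤ d) :
    |∑ m ∈ Icc 1 (N / d), (sawtooth (x / ((d * m : ℕ) : ℝ)) -
      sawtooth (x / (((d * m : ℕ) : ℝ) + 1)))| ≤
      602 * (x ^ (1 / 3 : ℝ) * (Nat.log 2 N + 1) * (d : ℝ) ^ (-(1 / 3) : ℝ) +
        2 * (N ^ 2 / x) * (d : ℝ) ^ (-1 : ℝ)) := by
  have hd0 : (0 : ℝ) < d := by exact_mod_cast hd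
  have hd1 : (1 : ℝ) ≤ d := by exact_mod_cast hd
  have hκ : 1 / (d : ℝ) ≤ 1 := by rwa [div_le_one hd0]
  have h1 := abs_sum_sawtooth_div_le (y := x / d) (κ := 0) (by positivity) le_rfl zero_le_one (N / d)
  have h2 := abs_sum_sawtooth_div_le (y := x / d) (κ := 1 / d) (by positivity) (by positivity) hκ
    (N / d)
  have e1 : ∑ m ∈ Icc 1 (N / d), sawtooth (x / ((d * m : ℕ) : ℝ)) =
      ∑ m ∈ Icc 1 (N / d), sawtooth (x / d / (m + 0)) :=
    sum_congr rfl fun m _ => by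
      push_cast
      rw [add_zero, div_div]
  have e2 : ∑ m ∈ Icc 1 (N / d), sawtooth (x / (((d * m : ℕ) : ℝ) + 1)) =
      ∑ m ∈ Icc 1 (N / d), sawtooth (x / d / (m + 1 / d)) :=
    sum_congr rfl fun m _ => by
      push_cast
      rw [div_div, mul_add, mul_one_div_cancel hd0.ne']
  have h3 : (x / d) ^ (1 / 3 : ℝ) * ((Nat.log 2 (N / d) : ℕ) + 1) + 2 * (((N / d : ℕ) : ℝ) ^ 2 / (x / d)) ≤
      x ^ (1 / 3 : ℝ) * (Nat.log 2 N + 1) * (d : ℝ) ^ (-(1 / 3) : ℝ) +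
        2 * (N ^ 2 / x) * (d : ℝ) ^ (-1 : ℝ) := by
    have h4 : (x / d) ^ (1 / 3 : ℝ) = x ^ (1 / 3 : ℝ) * (d : ℝ) ^ (-(1 / 3) : ℝ) := by
      rw [Real.div_rpow hx.le hd0.le, Real.rpow_neg hd0.le, div_eq_mul_inv]
    have h5 : (Nat.log 2 (N / d) : ℝ) ≤ Nat.log 2 N := by
      exact_mod_cast Nat.log_mono_right (Nat.div_le_self _ _)
    have h6 : ((N / d : ℕ) : ℝ) ≤ N / d := Nat.cast_div_le
    rw [h4, Real.rpow_neg_one]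
    have h7 : ((N / d : ℕ) : ℝ) ^ 2 / (x / d) ≤ ((N : ℝ) / d) ^ 2 / (x / d) := by gcongr
    have h8 : ((N : ℝ) / d) ^ 2 / (x / d) = N ^ 2 / x * (d : ℝ)⁻¹ := by field_simp
    have h9 : x ^ (1 / 3 : ℝ) * (d : ℝ) ^ (-(1 / 3) : ℝ) * (Nat.log 2 (N / d) + 1) ≤
        x ^ (1 / 3 : ℝ) * (d : ℝ) ^ (-(1 / 3) : ℝ) * (Nat.log 2 N + 1) := by gcongr
    linarith
  rw [sum_sub_distrib, e1, e2]
  refine (abs_sub _ _).trans ?_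
  linarith

lemma norm_sum_mul_sawtooth_le {f g : ArithmeticFunction ℂ}
    (hfg : ∀ n : ℕ, 1 ≤ n → f n = ∑ d ∈ n.divisors, g d) {x : ℝ} (hx : 0 < x) (N : ℕ) :
    ‖∑ n ∈ Icc 1 N, f n * ((sawtooth (x / n) - sawtooth (x / (n + 1)) : ℝ) : ℂ)‖ ≤
      602 * (x ^ (1 / 3 : ℝ) * (Nat.log 2 N + 1) * ∑ d ∈ Icc 1 N, ‖g d‖ * (d : ℝ) ^ (-(1 / 3) : ℝ) +
        2 * (N ^ 2 / x) * ∑ d ∈ Icc 1 N, ‖g d‖ * (d : ℝ) ^ (-1 : ℝ)) := by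
  rw [sum_mul_divisorSum hfg (fun n : ℕ => ((sawtooth (x / n) - sawtooth (x / (n + 1)) : ℝ) : ℂ))]
  refine (norm_sum_le _ _).trans ?_
  rw [mul_sum, mul_sum, ← sum_add_distrib, mul_sum]
  refine sum_le_sum fun d hd => ?_
  rw [norm_mul, ← Complex.ofReal_sum, Complex.norm_real, Real.norm_eq_abs]
  have h := abs_sum_sawtooth_multiples_le hx (N := N) (mem_Icc.1 hd).1
  refine (mul_le_mul_of_nonneg_left h (norm_nonneg _)).trans (le_of_eq ?_)
  ring

lemma norm_fracSum_sub_le {f g : ArithmeticFunction ℂ}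
    (hfg : ∀ n : ℕ, 1 ≤ n → f n = ∑ d ∈ n.divisors, g d) (hf : Summable (fracTerm f))
    {x : ℝ} (hx : 0 < x) (N : ℕ) :
    ‖fracSum f x - fracConst f * (x : ℂ)‖ ≤
      ∑ k ∈ (Icc 1 ⌊x⌋₊).filter (fun k : ℕ => N < ⌊x / (k : ℝ)⌋₊), ‖f ⌊x / (k : ℝ)⌋₊‖ +
      x * ‖∑' n, fracTerm f (n + (N + 1))‖ +
      602 * (x ^ (1 / 3 : ℝ) * (Nat.log 2 N + 1) * ∑ d ∈ Icc 1 N, ‖g d‖ * (d : ℝ) ^ (-(1 / 3) : ℝ) +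
        2 * (N ^ 2 / x) * ∑ d ∈ Icc 1 N, ‖g d‖ * (d : ℝ) ^ (-1 : ℝ)) := by
  have h1 : fracConst f = ∑ n ∈ Icc 1 N, fracTerm f n + ∑' n, fracTerm f (n + (N + 1)) := by
    rw [fracConst, ← hf.sum_add_tsum_nat_add (N + 1)]
    congr 1
    rw [range_eq_Ico, sum_eq_sum_Ico_succ_bot (Nat.succ_pos N)]
    simp only [fracTerm, ArithmeticFunction.map_zero, zero_div, zero_add]
    rfl
  have h2 : ∑ n ∈ Icc 1 N, f n * ((x / n - x / (n + 1) -
        (sawtooth (x / n) - sawtooth (x / (n + 1))) : ℝ) : ℂ) =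
      (∑ n ∈ Icc 1 N, fracTerm f n) * x -
        ∑ n ∈ Icc 1 N, f n * ((sawtooth (x / n) - sawtooth (x / (n + 1)) : ℝ) : ℂ) := by
    rw [sum_mul, ← sum_sub_distrib]
    refine sum_congr rfl fun n hn => ?_
    have hn0 : (n : ℂ) ≠ 0 := by
      exact_mod_cast (Nat.one_le_iff_ne_zero.1 (mem_Icc.1 hn).1)
    have hn1 : (n : ℂ) + 1 ≠ 0 := by exact_mod_cast Nat.succ_ne_zero n
    rw [fracTerm]
    push_cast
    field_simp
    ring
  rw [fracSum_eq f hx.le N, h2, h1]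
  have h3 : ∀ a b c d : ℂ, a + (b * x - c) - (b + d) * x = a - d * x - c := fun a b c d => by ring
  rw [h3]
  refine (norm_sub_le _ _).trans (add_le_add ((norm_sub_le _ _).trans
    (add_le_add (norm_sum_le _ _) ?_)) (norm_sum_mul_sawtooth_le hfg hx N))
  rw [norm_mul, Complex.norm_real, Real.norm_of_nonneg hx.le, mul_comm]

/-! ### Partial summation and elementary power and logarithm bounds. -/

lemma mul_one_sub_le_one_sub_rpow {p v : ℝ} (hp0 : 0 ≤ p) (hp1 : p ≤ 1) (hv : 0 ≤ v) :
    p * (1 - v) ≤ 1 - v ^ p := by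
  have h := rpow_one_add_le_one_add_mul_self (s := v - 1) (by linarith) hp0 hp1
  rw [add_sub_cancel] at h
  linarith

/-- Discrete form of `t^β d(t^(-s)) = (s/(s-β)) d(t^(β-s))`, making the Abel remainder telescope.
With `v = (1+1/n)^(-s)` and `p = (s-β)/s` it is Bernoulli's inequality `p(1-v) ≤ 1-v^p`. -/
lemma rpow_mul_sub_le {β s : ℝ} (hβ : 0 ≤ β) (hs : β < s) {n : ℕ} (hn : 1 ≤ n) :
    (n : ℝ) ^ β * ((n : ℝ) ^ (-s) - ((n : ℝ) + 1) ^ (-s)) ≤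
      s / (s - β) * ((n : ℝ) ^ (β - s) - ((n : ℝ) + 1) ^ (β - s)) := by
  have hn0 : (0 : ℝ) < n := by exact_mod_cast hn
  have hs0 : 0 < s := by linarith
  set p := (s - β) / s with hp
  have hp0 : 0 < p := div_pos (by linarith) hs0
  have hp1 : p ≤ 1 := by rw [hp, div_le_one hs0]; linarith
  have hps : -s * p = β - s := by rw [hp]; field_simp; ring
  set v := (((n : ℝ) + 1) / n) ^ (-s) with hv
  have hv0 : 0 ≤ v := by positivity
  have h1 := mul_one_sub_le_one_sub_rpow hp0.le hp1 hv0
  have h2 : ((n : ℝ) + 1) ^ (-s) = (n : ℝ) ^ (-s) * v := by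
    rw [hv, Real.div_rpow (by positivity) hn0.le, mul_div_cancel₀ _ (by positivity)]
  have h3 : ((n : ℝ) + 1) ^ (β - s) = (n : ℝ) ^ (β - s) * v ^ p := by
    rw [hv, ← Real.rpow_mul (by positivity), hps, Real.div_rpow (by positivity) hn0.le,
      mul_div_cancel₀ _ (by positivity)]
  have h4 : (n : ℝ) ^ β * (n : ℝ) ^ (-s) = (n : ℝ) ^ (β - s) := by
    rw [← Real.rpow_add hn0, sub_eq_add_neg]
  have h5 : s / (s - β) = 1 / p := by rw [hp, one_div_div]
  rw [h2, h3, h5, ← mul_one_sub, ← mul_one_sub, ← mul_assoc, h4, mul_left_comm]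
  refine mul_le_mul_of_nonneg_left ?_ (by positivity)
  rw [one_div_mul_eq_div, le_div_iff₀ hp0]
  linarith

/-- Partial summation: a bound `M n ^ β` for the partial sums of a nonnegative sequence bounds its
sums weighted by `d ^ (-s)` when `s > β`. -/
lemma sum_mul_rpow_neg_le {b : ℕ → ℝ} {M β s : ℝ} (hM : 0 ≤ M) (hβ : 0 ≤ β) (hs : β < s) {N : ℕ}
    (hb : ∀ n, 1 ≤ n → n ≤ N → ∑ d ∈ Icc 1 n, b d ≤ M * (n : ℝ) ^ β) :
    ∑ d ∈ Icc 1 N, b d * (d : ℝ) ^ (-s) ≤ M * (s / (s - β)) := by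
  have hc : 1 ≤ s / (s - β) := by rw [one_le_div (by linarith)]; linarith
  rcases Nat.eq_zero_or_pos N with rfl | hN
  · simp
    positivity
  have key : ∀ n, 1 ≤ n → n ≤ N → ∑ d ∈ Icc 1 n, b d * (d : ℝ) ^ (-s) ≤
      (∑ d ∈ Icc 1 n, b d) * (n : ℝ) ^ (-s) + M * (s / (s - β) * (1 - (n : ℝ) ^ (β - s))) := by
    intro n hn
    induction n, hn using Nat.le_induction with
    | base => simp
    | succ n hn ih =>
      intro hnN
      have h1 := ih (by omega)
      have hn0 : (0 : ℝ) < n := by exact_mod_cast hn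
      rw [sum_Icc_succ_top (by omega), sum_Icc_succ_top (by omega)]
      push_cast
      have h2 : (n : ℝ) ^ (-s) - ((n : ℝ) + 1) ^ (-s) ≥ 0 := by
        rw [ge_iff_le, sub_nonneg]
        exact Real.rpow_le_rpow_of_nonpos hn0 (by linarith) (by linarith)
      have h3 := mul_le_mul_of_nonneg_right (hb n hn (by omega)) h2
      have h4 := mul_le_mul_of_nonneg_left (rpow_mul_sub_le hβ hs hn) hM
      linarith
  refine (key N hN le_rfl).trans ?_
  have hN0 : (0 : ℝ) < N := by exact_mod_cast hN
  have h1 := mul_le_mul_of_nonneg_right (hb N hN le_rfl) (by positivity : 0 ≤ (N : ℝ) ^ (-s))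
  rw [mul_assoc, ← Real.rpow_add hN0, ← sub_eq_add_neg] at h1
  have h2 : 0 ≤ M * ((s / (s - β) - 1) * (N : ℝ) ^ (β - s)) := by
    have : 0 ≤ s / (s - β) - 1 := by linarith
    positivity
  linarith

lemma sum_rpow_neg_le {α : ℝ} (hα0 : 0 ≤ α) (hα1 : α < 1) (Y : ℕ) :
    ∑ k ∈ Icc 1 Y, (k : ℝ) ^ (-α) ≤ (Y : ℝ) ^ (1 - α) / (1 - α) := by
  have h1α : 0 < 1 - α := by linarith
  induction Y with
  | zero => simp [Real.zero_rpow h1α.ne']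
  | succ n ih =>
    rw [sum_Icc_succ_top (by omega)]
    have hn0 : (0 : ℝ) < (n : ℝ) + 1 := by positivity
    have h := mul_one_sub_le_one_sub_rpow h1α.le (by linarith)
      (v := n / ((n : ℝ) + 1)) (by positivity)
    rw [Real.div_rpow (by positivity) hn0.le] at h
    have h2 := mul_le_mul_of_nonneg_left h (by positivity : 0 ≤ ((n : ℝ) + 1) ^ (1 - α))
    have h3 : ((n : ℝ) + 1) ^ (1 - α) * ((1 - α) * (1 - n / ((n : ℝ) + 1))) =
        (1 - α) * ((n : ℝ) + 1) ^ (-α) := by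
      rw [sub_eq_add_neg 1 α, Real.rpow_add hn0, Real.rpow_one]
      field_simp
      ring
    have h4 : ((n : ℝ) + 1) ^ (1 - α) * (1 - (n : ℝ) ^ (1 - α) / ((n : ℝ) + 1) ^ (1 - α)) =
        ((n : ℝ) + 1) ^ (1 - α) - (n : ℝ) ^ (1 - α) := by
      field_simp
    rw [h3, h4] at h2
    push_cast
    rw [le_div_iff₀ h1α] at ih ⊢
    linarith

lemma rpow_neg_one_sub_le {ε t : ℝ} (hε : 0 < ε) (ht : 0 < t) :
    (t + 1) ^ (-1 - ε) ≤ 1 / ε * (t ^ (-ε) - (t + 1) ^ (-ε)) := by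
  have ht1 : 0 < t + 1 := by linarith
  have h1 : 1 + ε / (t + 1) ≤ (t / (t + 1)) ^ (-ε) := by
    rw [Real.rpow_def_of_pos (by positivity)]
    have h2 := Real.log_le_sub_one_of_pos (by positivity : 0 < t / (t + 1))
    have h3 : t / (t + 1) - 1 = -(1 / (t + 1)) := by
      field_simp
      ring
    have h4 := Real.add_one_le_exp (Real.log (t / (t + 1)) * -ε)
    have h5 : ε * (1 / (t + 1)) = ε / (t + 1) := mul_one_div _ _
    nlinarith
  rw [Real.div_rpow ht.le ht1.le, le_div_iff₀ (by positivity)] at h1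
  have h6 : (t + 1) ^ (-1 - ε) = (t + 1) ^ (-ε) / (t + 1) := by
    rw [show -1 - ε = -ε - 1 by ring, Real.rpow_sub_one ht1.ne']
  rw [h6, one_div_mul_eq_div, le_div_iff₀ hε]
  have h7 : (1 + ε / (t + 1)) * (t + 1) ^ (-ε) =
      (t + 1) ^ (-ε) + (t + 1) ^ (-ε) / (t + 1) * ε := by ring
  linarith

lemma sum_range_rpow_tail_le {ε : ℝ} (hε : 0 < ε) {N : ℕ} (hN : 1 ≤ N) (J : ℕ) :
    ∑ j ∈ range J, ((j + (N + 1) : ℕ) : ℝ) ^ (-1 - ε) ≤ 1 / ε * (N : ℝ) ^ (-ε) := by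
  have key : ∑ j ∈ range J, ((j + (N + 1) : ℕ) : ℝ) ^ (-1 - ε) ≤
      1 / ε * ((N : ℝ) ^ (-ε) - ((J + N : ℕ) : ℝ) ^ (-ε)) := by
    induction J with
    | zero => simp
    | succ J ih =>
      rw [sum_range_succ]
      have h := rpow_neg_one_sub_le hε (t := ((J + N : ℕ) : ℝ)) (by
        exact_mod_cast (by omega : 0 < J + N))
      have e : ((J + N : ℕ) : ℝ) + 1 = ((J + (N + 1) : ℕ) : ℝ) := by push_cast; ring
      have e2 : J + 1 + N = J + (N + 1) := by ring
      rw [e] at h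
      rw [e2]
      linarith
  refine key.trans ?_
  gcongr
  have : 0 ≤ ((J + N : ℕ) : ℝ) ^ (-ε) := by positivity
  linarith

/-- The constant depends on `θ`, so this serves only for convergence and where a large `x` can
absorb it. -/
lemma log_rpow_le {θ ε t : ℝ} (hθ : 0 ≤ θ) (hε : 0 < ε) (ht : 1 ≤ t) :
    Real.log t ^ θ ≤ (θ / ε) ^ θ * t ^ ε := by
  rcases hθ.eq_or_lt with rfl | hθ
  · simpa using Real.one_le_rpow ht hε.le
  have ht0 : 0 ≤ t := by linarith
  have h := Real.log_le_rpow_div ht0 (div_pos hε hθ)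
  calc Real.log t ^ θ ≤ (t ^ (ε / θ) / (ε / θ)) ^ θ :=
        Real.rpow_le_rpow (Real.log_nonneg ht) h hθ.le
    _ = (θ / ε * t ^ (ε / θ)) ^ θ := by
        congr 1
        field_simp
    _ = (θ / ε) ^ θ * t ^ ε := by
        rw [Real.mul_rpow (by positivity) (by positivity), ← Real.rpow_mul ht0,
          div_mul_cancel₀ _ hθ.ne']

/-- `log t ^ θ * t ^ (-ε)` is nonincreasing once `log t ≥ θ / ε`. -/
lemma log_rpow_le_mul_div_rpow {θ ε u t : ℝ} (hθ : 0 ≤ θ) (hε : 0 < ε) (hu : 1 < u) (hut : u ≤ t)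
    (h : θ / ε ≤ Real.log u) : Real.log t ^ θ ≤ Real.log u ^ θ * (t / u) ^ ε := by
  have hu0 : 0 < u := by linarith
  have ht0 : 0 < t := by linarith
  have hlu : 0 < Real.log u := Real.log_pos hu
  have hq : 0 < t / u := by positivity
  have hq1 : 0 ≤ Real.log (t / u) := Real.log_nonneg (by rwa [one_le_div hu0])
  have h1 : Real.log t = Real.log u * (1 + Real.log (t / u) / Real.log u) := by
    rw [Real.log_div ht0.ne' hu0.ne']
    field_simp
    ring
  rw [h1, Real.mul_rpow hlu.le (by positivity)]
  gcongr
  have h2 : 1 + Real.log (t / u) / Real.log u ≤ Real.exp (Real.log (t / u) / Real.log u) := by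
    linarith [Real.add_one_le_exp (Real.log (t / u) / Real.log u)]
  calc _ ≤ Real.exp (Real.log (t / u) / Real.log u) ^ θ := by gcongr
    _ = Real.exp (Real.log (t / u) * (θ / Real.log u)) := by
        rw [← Real.exp_mul]
        congr 1
        ring
    _ ≤ Real.exp (Real.log (t / u) * ε) := by
        gcongr
        rw [div_le_iff₀ hlu]
        rwa [div_le_iff₀ hε, mul_comm] at h
    _ = _ := by rw [Real.rpow_def_of_pos hq]

/-! ### Bounds for `f`, the tail of the series, and the large quotients. -/

section Estimates

variable {f g : ArithmeticFunction ℂ} {α θ K : ℝ}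

lemma norm_apply_le (hfg : ∀ n : ℕ, 1 ≤ n → f n = ∑ d ∈ n.divisors, g d)
    (hg : ∀ x : ℝ, 2 ≤ x → ∑ d ∈ Icc 1 ⌊x⌋₊, ‖g d‖ ≤ K * (x ^ α * Real.log x ^ θ))
    {n : ℕ} (hn : 2 ≤ n) : ‖f n‖ ≤ K * ((n : ℝ) ^ α * Real.log n ^ θ) := by
  rw [hfg n (by omega)]
  have h := hg n (by exact_mod_cast hn)
  rw [Nat.floor_natCast] at h
  refine (norm_sum_le _ _).trans ((sum_le_sum_of_subset_of_nonneg ?_ fun _ _ _ =>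
    norm_nonneg _).trans h)
  intro d hd
  rw [mem_Icc]
  exact ⟨Nat.pos_of_mem_divisors hd, Nat.divisor_le hd⟩

lemma nonneg_of_sum_norm_le
    (hg : ∀ x : ℝ, 2 ≤ x → ∑ d ∈ Icc 1 ⌊x⌋₊, ‖g d‖ ≤ K * (x ^ α * Real.log x ^ θ)) : 0 ≤ K := by
  have h := hg 2 le_rfl
  have h1 : 0 ≤ ∑ d ∈ Icc 1 ⌊(2 : ℝ)⌋₊, ‖g d‖ := sum_nonneg fun _ _ => norm_nonneg _
  have h2 : 0 < (2 : ℝ) ^ α * Real.log 2 ^ θ := by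
    have : 0 < Real.log 2 := Real.log_pos one_lt_two
    positivity
  exact nonneg_of_mul_nonneg_left (h1.trans h) h2

/-- A bound for the partial sums of `‖g‖` by a pure power, up to the range `N`. -/
lemma sum_norm_le_mul_rpow
    (hg : ∀ x : ℝ, 2 ≤ x → ∑ d ∈ Icc 1 ⌊x⌋₊, ‖g d‖ ≤ K * (x ^ α * Real.log x ^ θ))
    {L γ : ℝ} (hγ1 : γ ≤ 1) {N : ℕ}
    (hL : ∀ n : ℕ, 2 ≤ n → n ≤ max N 2 → Real.log n ^ θ ≤ L * (n : ℝ) ^ (γ - α))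
    {n : ℕ} (hn : 1 ≤ n) (hnN : n ≤ N) :
    ∑ d ∈ Icc 1 n, ‖g d‖ ≤ K * (2 * L) * (n : ℝ) ^ γ := by
  have hK := nonneg_of_sum_norm_le hg
  have hlarge : ∀ n : ℕ, 2 ≤ n → n ≤ max N 2 → ∑ d ∈ Icc 1 n, ‖g d‖ ≤ K * (L * (n : ℝ) ^ γ) := by
    intro n h2 hn
    have hn0 : (0 : ℝ) < n := by exact_mod_cast (by omega : 0 < n)
    have h := hg n (by exact_mod_cast h2)
    rw [Nat.floor_natCast] at h
    refine h.trans (mul_le_mul_of_nonneg_left ?_ hK)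
    calc (n : ℝ) ^ α * Real.log n ^ θ ≤ (n : ℝ) ^ α * (L * (n : ℝ) ^ (γ - α)) := by
          gcongr
          exact hL n h2 hn
      _ = L * ((n : ℝ) ^ α * (n : ℝ) ^ (γ - α)) := by ring
      _ = _ := by rw [← Real.rpow_add hn0, add_sub_cancel]
  have hL0 : 0 ≤ L := by
    have h := hL 2 le_rfl (le_max_right _ _)
    have h1 : 0 ≤ Real.log ((2 : ℕ) : ℝ) := Real.log_natCast_nonneg 2
    have h2 : 0 ≤ Real.log ((2 : ℕ) : ℝ) ^ θ := by positivity
    exact nonneg_of_mul_nonneg_left (h2.trans h) (by positivity)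
  -- The hypothesis starts at 2, so `n = 1` borrows the bound at 2; this costs the factor 2 and
  -- explains `max N 2`.
  rcases Nat.lt_or_ge n 2 with h | h
  · obtain rfl : n = 1 := by omega
    have h1 := hlarge 2 le_rfl (le_max_right _ _)
    have h2 : ∑ d ∈ Icc 1 1, ‖g d‖ ≤ ∑ d ∈ Icc 1 2, ‖g d‖ :=
      sum_le_sum_of_subset_of_nonneg (Icc_subset_Icc_right one_le_two) fun _ _ _ => norm_nonneg _
    refine h2.trans (h1.trans ?_)
    have h3 : ((2 : ℕ) : ℝ) ^ γ ≤ 2 := by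
      calc ((2 : ℕ) : ℝ) ^ γ ≤ ((2 : ℕ) : ℝ) ^ (1 : ℝ) :=
            Real.rpow_le_rpow_of_exponent_le (by norm_num) hγ1
        _ = 2 := by norm_num
    rw [Nat.cast_one, Real.one_rpow, mul_one]
    refine mul_le_mul_of_nonneg_left ?_ hK
    nlinarith
  · have h1 := hlarge n h (hnN.trans (le_max_left _ _))
    refine h1.trans ?_
    have : 0 ≤ K * (L * (n : ℝ) ^ γ) := by positivity
    linarith

lemma norm_fracTerm_le {n : ℕ} (hn : 1 ≤ n) : ‖fracTerm f n‖ ≤ ‖f n‖ * (n : ℝ) ^ (-2 : ℝ) := by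
  have hn0 : (0 : ℝ) < n := by exact_mod_cast hn
  have h1 : ‖(n : ℂ) + 1‖ = (n : ℝ) + 1 := by
    exact_mod_cast Complex.norm_natCast (n + 1)
  rw [fracTerm, norm_div, norm_mul, Complex.norm_natCast, h1, Real.rpow_neg hn0.le, ← div_eq_mul_inv]
  gcongr
  rw [Real.rpow_two, sq]
  gcongr
  linarith

lemma summable_fracTerm (hθ : 0 ≤ θ) (hα1 : α < 1)
    (hfg : ∀ n : ℕ, 1 ≤ n → f n = ∑ d ∈ n.divisors, g d)
    (hg : ∀ x : ℝ, 2 ≤ x → ∑ d ∈ Icc 1 ⌊x⌋₊, ‖g d‖ ≤ K * (x ^ α * Real.log x ^ θ)) :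
    Summable (fracTerm f) := by
  have hK := nonneg_of_sum_norm_le hg
  set ε := (1 - α) / 2 with hε
  have hε0 : 0 < ε := by rw [hε]; linarith
  refine Summable.of_norm_bounded_eventually_nat
    (g := fun n : ℕ => K * (θ / ε) ^ θ * (n : ℝ) ^ (-1 - ε)) ?_ ?_
  · exact (Real.summable_nat_rpow.2 (by linarith)).mul_left _
  · filter_upwards [Filter.eventually_ge_atTop 2] with n hn
    have hn0 : (0 : ℝ) < n := by exact_mod_cast (by omega : 0 < n)
    refine (norm_fracTerm_le (by omega)).trans ?_
    have h1 := norm_apply_le hfg hg hn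
    have h2 := log_rpow_le hθ hε0 (by exact_mod_cast (by omega : 1 ≤ n) : (1 : ℝ) ≤ n)
    calc _ ≤ K * ((n : ℝ) ^ α * ((θ / ε) ^ θ * (n : ℝ) ^ ε)) * (n : ℝ) ^ (-2 : ℝ) := by
          refine mul_le_mul_of_nonneg_right (h1.trans ?_) (by positivity)
          gcongr
      _ = K * (θ / ε) ^ θ * ((n : ℝ) ^ α * (n : ℝ) ^ ε * (n : ℝ) ^ (-2 : ℝ)) := by ring
      _ = _ := by
          rw [← Real.rpow_add hn0, ← Real.rpow_add hn0]
          congr 2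
          rw [hε]
          ring

/-- Half of the exponent `1-α` is spent on the monotonicity of `(log t)^θ t^(-ε)`, so that `(log
N)^θ` factors out with a constant free of `θ`; this is why `log N` must be large. -/
lemma norm_tsum_fracTerm_tail_le (hθ : 0 ≤ θ) (hα1 : α < 1)
    (hfg : ∀ n : ℕ, 1 ≤ n → f n = ∑ d ∈ n.divisors, g d)
    (hg : ∀ x : ℝ, 2 ≤ x → ∑ d ∈ Icc 1 ⌊x⌋₊, ‖g d‖ ≤ K * (x ^ α * Real.log x ^ θ))
    {N : ℕ} (hN : 2 ≤ N) (hlog : θ / ((1 - α) / 2) ≤ Real.log N) :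
    ‖∑' n, fracTerm f (n + (N + 1))‖ ≤
      2 / (1 - α) * K * (Real.log N ^ θ * (N : ℝ) ^ (α - 1)) := by
  have hK := nonneg_of_sum_norm_le hg
  set ε := (1 - α) / 2 with hε
  have hε0 : 0 < ε := by rw [hε]; linarith
  have hN0 : (0 : ℝ) < N := by exact_mod_cast (by omega : 0 < N)
  have hN1 : (1 : ℝ) < N := by exact_mod_cast (by omega : 1 < N)
  have hlogN : 0 ≤ Real.log N := Real.log_natCast_nonneg N
  have hs := (summable_nat_add_iff (N + 1)).2 (summable_fracTerm hθ hα1 hfg hg)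
  refine le_of_tendsto' hs.hasSum.tendsto_sum_nat.norm fun J => ?_
  have hterm : ∀ j ∈ range J, ‖fracTerm f (j + (N + 1))‖ ≤
      K * Real.log N ^ θ * (N : ℝ) ^ (-ε) * ((j + (N + 1) : ℕ) : ℝ) ^ (-1 - ε) := by
    intro j _
    have hnN : (N : ℝ) ≤ ((j + (N + 1) : ℕ) : ℝ) := by exact_mod_cast (by omega)
    have hn2 : 2 ≤ j + (N + 1) := by omega
    generalize j + (N + 1) = n at *
    have hn0 : (0 : ℝ) < n := by linarith
    refine (norm_fracTerm_le (by omega)).trans ?_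
    have h1 := norm_apply_le hfg hg hn2
    have h2 := log_rpow_le_mul_div_rpow hθ hε0 hN1 hnN hlog
    calc _ ≤ K * ((n : ℝ) ^ α * (Real.log N ^ θ * ((n : ℝ) / N) ^ ε)) * (n : ℝ) ^ (-2 : ℝ) := by
          refine mul_le_mul_of_nonneg_right (h1.trans ?_) (by positivity)
          gcongr
      _ = K * Real.log N ^ θ * (N : ℝ) ^ (-ε) *
          ((n : ℝ) ^ α * (n : ℝ) ^ ε * (n : ℝ) ^ (-2 : ℝ)) := by
          rw [Real.div_rpow hn0.le hN0.le, Real.rpow_neg hN0.le]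
          ring
      _ = _ := by
          rw [← Real.rpow_add hn0, ← Real.rpow_add hn0]
          congr 2
          rw [hε]
          ring
  refine (norm_sum_le _ _).trans ((sum_le_sum hterm).trans ?_)
  rw [← mul_sum]
  have h3 : 1 / ε = 2 / (1 - α) := by rw [hε, one_div_div]
  have h4 : (N : ℝ) ^ (-ε) * (N : ℝ) ^ (-ε) = (N : ℝ) ^ (α - 1) := by
    rw [← Real.rpow_add hN0, hε]
    congr 1
    ring
  calc _ ≤ K * Real.log N ^ θ * (N : ℝ) ^ (-ε) * (1 / ε * (N : ℝ) ^ (-ε)) := by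
        gcongr
        exact sum_range_rpow_tail_le hε0 (by omega) J
    _ = 1 / ε * K * (Real.log N ^ θ * ((N : ℝ) ^ (-ε) * (N : ℝ) ^ (-ε))) := by ring
    _ = _ := by rw [h3, h4]

lemma sum_norm_large_le (hθ : 0 ≤ θ) (hα0 : 0 ≤ α) (hα1 : α < 1)
    (hfg : ∀ n : ℕ, 1 ≤ n → f n = ∑ d ∈ n.divisors, g d)
    (hg : ∀ x : ℝ, 2 ≤ x → ∑ d ∈ Icc 1 ⌊x⌋₊, ‖g d‖ ≤ K * (x ^ α * Real.log x ^ θ))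
    {x : ℝ} (hx : 1 ≤ x) {N : ℕ} (hN : 1 ≤ N) :
    ∑ k ∈ (Icc 1 ⌊x⌋₊).filter (fun k : ℕ => N < ⌊x / (k : ℝ)⌋₊), ‖f ⌊x / (k : ℝ)⌋₊‖ ≤
      1 / (1 - α) * K * (Real.log x ^ θ * (x * (N : ℝ) ^ (α - 1))) := by
  have hK := nonneg_of_sum_norm_le hg
  have hx0 : 0 < x := by linarith
  have hN0 : (0 : ℝ) < N := by exact_mod_cast hN
  have hlogx : 0 ≤ Real.log x := Real.log_nonneg hx
  have h1α : 0 < 1 - α := by linarith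
  have hsub : (Icc 1 ⌊x⌋₊).filter (fun k : ℕ => N < ⌊x / (k : ℝ)⌋₊) ⊆ Icc 1 ⌊x / N⌋₊ := by
    intro k hk
    obtain ⟨hk1, hk2⟩ := mem_filter.1 hk
    have hk1 := (mem_Icc.1 hk1).1
    have hk0 : (0 : ℝ) < k := by exact_mod_cast hk1
    refine mem_Icc.2 ⟨hk1, Nat.le_floor ?_⟩
    have h := (Nat.le_floor_iff (by positivity)).1 hk2.le
    rw [le_div_iff₀ hk0] at h
    rw [le_div_iff₀ hN0]
    linarith
  have hterm : ∀ k ∈ (Icc 1 ⌊x⌋₊).filter (fun k : ℕ => N < ⌊x / (k : ℝ)⌋₊),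
      ‖f ⌊x / (k : ℝ)⌋₊‖ ≤ K * Real.log x ^ θ * x ^ α * (k : ℝ) ^ (-α) := by
    intro k hk
    obtain ⟨hk1, hk2⟩ := mem_filter.1 hk
    have hk1 := (mem_Icc.1 hk1).1
    have hk0 : (0 : ℝ) < k := by exact_mod_cast hk1
    have hk1' : (1 : ℝ) ≤ k := by exact_mod_cast hk1
    have hfl : (⌊x / (k : ℝ)⌋₊ : ℝ) ≤ x / k := Nat.floor_le (by positivity)
    have hn2 : 2 ≤ ⌊x / (k : ℝ)⌋₊ := by omega
    have hn0 : (0 : ℝ) < ⌊x / (k : ℝ)⌋₊ := by exact_mod_cast (by omega : 0 < ⌊x / (k : ℝ)⌋₊)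
    refine (norm_apply_le hfg hg hn2).trans ?_
    have h1 : (⌊x / (k : ℝ)⌋₊ : ℝ) ^ α ≤ (x / k) ^ α := Real.rpow_le_rpow hn0.le hfl hα0
    have h2 : Real.log (⌊x / (k : ℝ)⌋₊ : ℝ) ^ θ ≤ Real.log x ^ θ := by
      refine Real.rpow_le_rpow (Real.log_natCast_nonneg _) ?_ hθ
      exact Real.log_le_log hn0 (hfl.trans (div_le_self hx0.le hk1'))
    calc _ ≤ K * ((x / k) ^ α * Real.log x ^ θ) := by gcongr
      _ = _ := by
        rw [Real.div_rpow hx0.le hk0.le, Real.rpow_neg hk0.le]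
        ring
  refine (sum_le_sum hterm).trans ?_
  refine (sum_le_sum_of_subset_of_nonneg hsub fun k _ _ => by positivity).trans ?_
  rw [← mul_sum]
  have h3 : ((⌊x / N⌋₊ : ℕ) : ℝ) ^ (1 - α) ≤ (x / N) ^ (1 - α) :=
    Real.rpow_le_rpow (by positivity) (Nat.floor_le (by positivity)) h1α.le
  calc _ ≤ K * Real.log x ^ θ * x ^ α * ((x / N) ^ (1 - α) / (1 - α)) := by
        gcongr
        refine (sum_rpow_neg_le hα0 hα1 _).trans ?_
        gcongr
    _ = 1 / (1 - α) * K * (Real.log x ^ θ * (x ^ α * x ^ (1 - α) * (N : ℝ) ^ (α - 1))) := by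
        rw [Real.div_rpow hx0.le hN0.le, show α - 1 = -(1 - α) by ring, Real.rpow_neg hN0.le]
        ring
    _ = _ := by rw [← Real.rpow_add hx0, add_sub_cancel, Real.rpow_one]

end Estimates

/-! ### The weighted sum of `g`, and the final assembly. -/

lemma eventually_floor_rpow {β : ℝ} (hβ : 0 < β) (m : ℕ) :
    ∀ᶠ x : ℝ in atTop, m ≤ ⌊x ^ β⌋₊ :=
  (tendsto_nat_floor_atTop.comp (tendsto_rpow_atTop hβ)).eventually_ge_atTop m

/-- The factor `log x` comes from the dyadic blocks. For `α > 0` the target exceeds the true size by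
a power of `x`, which absorbs it; for `α = 0` it survives as `max(1, θ)`. Only the threshold may
depend on `θ`. -/
lemma eventually_log_mul_sum_le (α : ℝ) (hα0 : 0 ≤ α) (hα1 : α < 1) :
    ∃ C : ℝ, 0 < C ∧ ∀ θ : ℝ, 0 ≤ θ → ∀ᶠ x : ℝ in atTop, ∀ (g : ArithmeticFunction ℂ) (K : ℝ),
      (∀ x : ℝ, 2 ≤ x → ∑ d ∈ Icc 1 ⌊x⌋₊, ‖g d‖ ≤ K * (x ^ α * Real.log x ^ θ)) →
      Real.log x * ∑ d ∈ Icc 1 ⌊x ^ (2 / (3 - α))⌋₊, ‖g d‖ * (d : ℝ) ^ (-(1 / 3) : ℝ) ≤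
        C * K * (x ^ ((1 + α) / (3 - α) - 1 / 3) * Real.log x ^ logExponent α θ) := by
  have h3α : 0 < 3 - α := by linarith
  rcases hα0.eq_or_lt with rfl | hαpos
  -- `24 = 4 · 6`: partial summation with `β = 1/6`, `s = 1/3` gives 4. The remaining `(6θ)^θ` is at
  -- most 6 if `θ ≤ 1`, and otherwise is absorbed by `(log x)^(θ-1)`.
  · refine ⟨24, by norm_num, fun θ hθ => ?_⟩
    have hL : ∀ᶠ x : ℝ in atTop,
        Real.log x * (θ / (1 / 6)) ^ θ ≤ 6 * Real.log x ^ logExponent 0 θ := by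
      rw [logExponent, if_pos rfl]
      rcases le_or_gt θ 1 with h | h
      · filter_upwards [eventually_ge_atTop 1] with x hx
        rw [max_eq_left h, Real.rpow_one]
        have h1 : (θ / (1 / 6)) ^ θ ≤ 6 := by
          calc (θ / (1 / 6)) ^ θ ≤ (6 : ℝ) ^ θ := by
                refine Real.rpow_le_rpow (by positivity) (by linarith) hθ
            _ ≤ (6 : ℝ) ^ (1 : ℝ) := Real.rpow_le_rpow_of_exponent_le (by norm_num) h
            _ = 6 := Real.rpow_one _
        nlinarith [Real.log_nonneg hx]
      · have ht := (tendsto_rpow_atTop (by linarith : 0 < θ - 1)).comp Real.tendsto_log_atTop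
        filter_upwards [ht.eventually_ge_atTop ((θ / (1 / 6)) ^ θ), eventually_gt_atTop 1]
          with x hx hx1
        have hl := Real.log_pos hx1
        rw [max_eq_right h.le]
        have h2 : Real.log x ^ θ = Real.log x * Real.log x ^ (θ - 1) := by
          rw [Real.rpow_sub_one hl.ne']
          field_simp
        rw [h2]
        have hx : (θ / (1 / 6)) ^ θ ≤ Real.log x ^ (θ - 1) := hx
        have := mul_le_mul_of_nonneg_left hx hl.le
        have : 0 ≤ Real.log x * Real.log x ^ (θ - 1) := by positivity
        linarith
    filter_upwards [hL, eventually_ge_atTop 1] with x hx hx1 g K hg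
    have hK := nonneg_of_sum_norm_le hg
    have hpart := fun n hn hnN => sum_norm_le_mul_rpow hg (L := (θ / (1 / 6)) ^ θ) (γ := 1 / 6)
      (by norm_num) (N := ⌊x ^ (2 / (3 - 0) : ℝ)⌋₊)
      (fun n hn _ => by
        rw [sub_zero]
        exact log_rpow_le hθ (by norm_num) (by exact_mod_cast (by omega : 1 ≤ n)))
      (n := n) hn hnN
    have hsum := sum_mul_rpow_neg_le (s := 1 / 3) (by positivity) (by norm_num) (by norm_num) hpart
    have e : (1 + 0) / (3 - 0) - 1 / 3 = (0 : ℝ) := by norm_num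
    rw [e, Real.rpow_zero, one_mul]
    calc _ ≤ Real.log x * (K * (2 * (θ / (1 / 6)) ^ θ) * (1 / 3 / (1 / 3 - 1 / 6))) :=
          mul_le_mul_of_nonneg_left hsum (Real.log_nonneg hx1)
      _ = 4 * K * (Real.log x * (θ / (1 / 6)) ^ θ) := by ring
      _ ≤ 4 * K * (6 * Real.log x ^ logExponent 0 θ) := by gcongr
      _ = _ := by ring
  -- Partial summation needs `s > α`; raising the weight from `d^(-1/3)` to `d^(-s)` costs
  -- `x^(β(s-1/3))`, affordable when `s < (1+2α)/3`. Such `s` exists because `0 < α < 1`, and the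
  -- slack `x^η` swallows `log x`.
  · set s := (max α (1 / 3) + (1 + 2 * α) / 3) / 2 with hs
    have hm1 := le_max_left α (1 / 3)
    have hm2 := le_max_right α (1 / 3)
    have hm3 : max α (1 / 3) < (1 + 2 * α) / 3 := max_lt (by linarith) (by linarith)
    have hsα : α < s := by linarith
    have hs3 : 1 / 3 < s := by linarith
    have hsu : s < (1 + 2 * α) / 3 := by linarith
    set β := 2 / (3 - α) with hβ
    have hβ0 : 0 < β := by positivity
    have hβ1 : β ≤ 1 := by rw [hβ, div_le_one h3α]; linarith
    set η := β * ((1 + 2 * α) / 3 - s) with hη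
    have hη0 : 0 < η := mul_pos hβ0 (by linarith)
    have hexp : η + β * (s - 1 / 3) = (1 + α) / (3 - α) - 1 / 3 := by
      rw [hη, hβ]
      field_simp
      ring
    refine ⟨2 * (s / (s - α)), by have : 0 < s - α := by linarith
                                  positivity, fun θ hθ => ?_⟩
    have hlogx := (isLittleO_log_rpow_atTop hη0).bound one_pos
    filter_upwards [hlogx, eventually_ge_atTop 2] with x hx hx2 g K hg
    have hK := nonneg_of_sum_norm_le hg
    have hx0 : 0 < x := by linarith
    have hl0 : 0 ≤ Real.log x := Real.log_nonneg (by linarith)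
    rw [one_mul, Real.norm_of_nonneg hl0, Real.norm_of_nonneg (by positivity)] at hx
    set N := ⌊x ^ β⌋₊ with hN
    have hNβ : (N : ℝ) ≤ x ^ β := Nat.floor_le (by positivity)
    have hNx : (N : ℝ) ≤ x := by
      refine hNβ.trans ?_
      calc x ^ β ≤ x ^ (1 : ℝ) := Real.rpow_le_rpow_of_exponent_le (by linarith) hβ1
        _ = x := Real.rpow_one x
    have hpart := fun n hn hnN => sum_norm_le_mul_rpow hg (L := Real.log x ^ θ) (γ := α)
      hα1.le (N := N)
      (fun n hn hn' => by
        rw [sub_self, Real.rpow_zero, mul_one]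
        have h1 : (n : ℝ) ≤ max (N : ℝ) 2 := by exact_mod_cast hn'
        have h2 : (n : ℝ) ≤ x := h1.trans (max_le hNx hx2)
        have hn0 : (0 : ℝ) < n := by exact_mod_cast (by omega : 0 < n)
        exact Real.rpow_le_rpow (Real.log_natCast_nonneg n) (Real.log_le_log hn0 h2) hθ)
      (n := n) hn hnN
    have hsum := sum_mul_rpow_neg_le (by positivity) hα0 hsα hpart
    have hweight : ∑ d ∈ Icc 1 N, ‖g d‖ * (d : ℝ) ^ (-(1 / 3) : ℝ) ≤
        x ^ (β * (s - 1 / 3)) * ∑ d ∈ Icc 1 N, ‖g d‖ * (d : ℝ) ^ (-s) := by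
      rw [mul_sum]
      refine sum_le_sum fun d hd => ?_
      have hd0 : (0 : ℝ) < d := by exact_mod_cast (mem_Icc.1 hd).1
      have hdN : (d : ℝ) ≤ x ^ β := le_trans (by exact_mod_cast (mem_Icc.1 hd).2) hNβ
      have h1 : (d : ℝ) ^ (s - 1 / 3) ≤ x ^ (β * (s - 1 / 3)) := by
        rw [Real.rpow_mul hx0.le]
        exact Real.rpow_le_rpow hd0.le hdN (by linarith)
      have h2 : (d : ℝ) ^ (-(1 / 3) : ℝ) = (d : ℝ) ^ (s - 1 / 3) * (d : ℝ) ^ (-s) := by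
        rw [← Real.rpow_add hd0]
        congr 1
        ring
      rw [h2]
      calc _ ≤ ‖g d‖ * (x ^ (β * (s - 1 / 3)) * (d : ℝ) ^ (-s)) := by gcongr
        _ = _ := by ring
    have hθ' : logExponent α θ = θ := if_neg hαpos.ne'
    rw [hθ', ← hexp, Real.rpow_add hx0]
    calc _ ≤ x ^ η * (x ^ (β * (s - 1 / 3)) * (K * (2 * Real.log x ^ θ) * (s / (s - α)))) := by
          refine mul_le_mul hx (hweight.trans ?_) (sum_nonneg fun d _ => by positivity)
            (by positivity)
          gcongr
      _ = _ := by ring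

theorem theorem2 (α : ℝ) (hα0 : 0 ≤ α) (hα1 : α < 1) :
    ∃ C : ℝ, 0 < C ∧ ∀ θ : ℝ, 0 ≤ θ → ∃ x₀ : ℝ, 2 ≤ x₀ ∧
      ∀ (f g : ArithmeticFunction ℂ) (K : ℝ),
        (∀ n : ℕ, 1 ≤ n → f n = ∑ d ∈ n.divisors, g d) →
        (∀ x : ℝ, 2 ≤ x →
          ∑ d ∈ Finset.Icc 1 ⌊x⌋₊, ‖g d‖ ≤ K * (x ^ α * Real.log x ^ θ)) →
        Summable (fracTerm f) ∧
        ∀ x : ℝ, x₀ ≤ x →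
          ‖fracSum f x - fracConst f * (x : ℂ)‖ ≤
            C * K * (x ^ ((1 + α) / (3 - α)) * Real.log x ^ logExponent α θ) := by
  obtain ⟨C, hC, hCθ⟩ := eventually_log_mul_sum_le α hα0 hα1
  have h1α : 0 < 1 - α := by linarith
  have h3α : 0 < 3 - α := by linarith
  set β := 2 / (3 - α) with hβ
  have hβ0 : 0 < β := by positivity
  have hβ1 : β ≤ 1 := by rw [hβ, div_le_one h3α]; linarith
  set e := (1 + α) / (3 - α) with he
  have he1 : 1 + β * (α - 1) = e := by rw [hβ, he]; field_simp; ring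
  have he2 : 2 * β - 1 = e := by rw [hβ, he]; field_simp; ring
  refine ⟨6 / (1 - α) + 602 * (3 * C + 4 / (1 - α)), by positivity, fun θ hθ => ?_⟩
  -- Besides the weighted-sum bound, `x` must be so large that `N ≥ 2` and `log N ≥ 2θ/(1-α)`, as
  -- the tail estimate requires.
  obtain ⟨x₁, hx₁⟩ := eventually_atTop.1 ((hCθ θ hθ).and
    (eventually_floor_rpow hβ0 (max 2 ⌈Real.exp (θ / ((1 - α) / 2))⌉₊)))
  refine ⟨max 3 x₁, le_trans (by norm_num) (le_max_left _ _), fun f g K hfg hg =>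
    ⟨summable_fracTerm hθ hα1 hfg hg, fun x hx => ?_⟩⟩
  have hK := nonneg_of_sum_norm_le hg
  have hx3 : 3 ≤ x := (le_max_left _ _).trans hx
  have hx0 : 0 < x := by linarith
  obtain ⟨hA, hNlarge⟩ := hx₁ x ((le_max_right _ _).trans hx)
  have hA := hA g K hg
  set N := ⌊x ^ β⌋₊ with hN
  have hN2 : 2 ≤ N := (le_max_left _ _).trans hNlarge
  have hN0 : (0 : ℝ) < N := by exact_mod_cast (by omega : 0 < N)
  have hNβ : (N : ℝ) ≤ x ^ β := Nat.floor_le (by positivity)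
  have hNx : (N : ℝ) ≤ x := by
    refine hNβ.trans ?_
    calc x ^ β ≤ x ^ (1 : ℝ) := Real.rpow_le_rpow_of_exponent_le (by linarith) hβ1
      _ = x := Real.rpow_one x
  have hNlow : x ^ β / 2 ≤ N := by
    have h1 := Nat.lt_floor_add_one (x ^ β)
    have h2 : (2 : ℝ) ≤ N := by exact_mod_cast hN2
    linarith
  have hlogN : θ / ((1 - α) / 2) ≤ Real.log N := by
    rw [Real.le_log_iff_exp_le hN0]
    exact (Nat.le_ceil _).trans (by exact_mod_cast (le_max_right _ _).trans hNlarge)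
  -- From `x ≥ 3 > e`; it allows the exponent `θ` of `log x` to be raised to `logExponent α θ`.
  have hl1 : 1 ≤ Real.log x := by
    rw [Real.le_log_iff_exp_le hx0]
    exact Real.exp_one_lt_three.le.trans hx3
  have hl0 : 0 ≤ Real.log x := by linarith
  have hθle : θ ≤ logExponent α θ := by
    rw [logExponent]
    split_ifs
    · exact le_max_right _ _
    · exact le_rfl
  have hlogle : Real.log x ^ θ ≤ Real.log x ^ logExponent α θ :=
    Real.rpow_le_rpow_of_exponent_le hl1 hθle
  set E := x ^ e * Real.log x ^ logExponent α θ with hE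
  have hE0 : 0 ≤ E := by positivity
  have hxe : x ^ e * Real.log x ^ θ ≤ E := by
    rw [hE]
    gcongr
  have hpow : x * (N : ℝ) ^ (α - 1) ≤ 2 * x ^ e := by
    have h1 : (N : ℝ) ^ (α - 1) ≤ (x ^ β / 2) ^ (α - 1) :=
      Real.rpow_le_rpow_of_nonpos (by positivity) hNlow (by linarith)
    have h2 : (x ^ β / 2) ^ (α - 1) = x ^ (β * (α - 1)) * (2 : ℝ) ^ (1 - α) := by
      rw [Real.div_rpow (by positivity) (by norm_num), ← Real.rpow_mul hx0.le, div_eq_mul_inv,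
        ← Real.rpow_neg (by norm_num), neg_sub]
    have h3 : (2 : ℝ) ^ (1 - α) ≤ 2 := by
      calc (2 : ℝ) ^ (1 - α) ≤ (2 : ℝ) ^ (1 : ℝ) :=
            Real.rpow_le_rpow_of_exponent_le (by norm_num) (by linarith)
        _ = 2 := Real.rpow_one _
    calc x * (N : ℝ) ^ (α - 1) ≤ x * (x ^ (β * (α - 1)) * 2) := by
          rw [h2] at h1
          gcongr
          refine h1.trans ?_
          gcongr
      _ = 2 * (x ^ (1 : ℝ) * x ^ (β * (α - 1))) := by rw [Real.rpow_one]; ring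
      _ = _ := by rw [← Real.rpow_add hx0, he1]
  have hT1 : ∑ k ∈ (Icc 1 ⌊x⌋₊).filter (fun k : ℕ => N < ⌊x / (k : ℝ)⌋₊),
      ‖f ⌊x / (k : ℝ)⌋₊‖ ≤ 2 / (1 - α) * K * E := by
    refine (sum_norm_large_le hθ hα0 hα1 hfg hg (by linarith) (by omega)).trans ?_
    calc _ ≤ 1 / (1 - α) * K * (Real.log x ^ θ * (2 * x ^ e)) := by gcongr
      _ = 2 / (1 - α) * K * (x ^ e * Real.log x ^ θ) := by ring
      _ ≤ _ := by gcongr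
  have hT2 : x * ‖∑' n, fracTerm f (n + (N + 1))‖ ≤ 4 / (1 - α) * K * E := by
    have h1 := norm_tsum_fracTerm_tail_le hθ hα1 hfg hg hN2 hlogN
    have h2 : Real.log N ^ θ ≤ Real.log x ^ θ :=
      Real.rpow_le_rpow (Real.log_natCast_nonneg N) (Real.log_le_log hN0 hNx) hθ
    calc _ ≤ x * (2 / (1 - α) * K * (Real.log N ^ θ * (N : ℝ) ^ (α - 1))) := by gcongr
      _ ≤ x * (2 / (1 - α) * K * (Real.log x ^ θ * (N : ℝ) ^ (α - 1))) := by gcongr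
      _ = 2 / (1 - α) * K * (Real.log x ^ θ * (x * (N : ℝ) ^ (α - 1))) := by ring
      _ ≤ 2 / (1 - α) * K * (Real.log x ^ θ * (2 * x ^ e)) := by gcongr
      _ = 4 / (1 - α) * K * (x ^ e * Real.log x ^ θ) := by ring
      _ ≤ _ := by gcongr
  have hT3 : x ^ (1 / 3 : ℝ) * (Nat.log 2 N + 1) *
      ∑ d ∈ Icc 1 N, ‖g d‖ * (d : ℝ) ^ (-(1 / 3) : ℝ) ≤ 3 * C * K * E := by
    have h1 : (Nat.log 2 N : ℝ) + 1 ≤ 3 * Real.log x := by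
      have h2 : (Nat.log 2 N : ℝ) * Real.log 2 ≤ Real.log x := by
        rw [← Real.log_pow]
        refine Real.log_le_log (by positivity) (le_trans ?_ hNx)
        exact_mod_cast Nat.pow_log_le_self 2 (by omega)
      have h3 : (1 : ℝ) / 2 ≤ Real.log 2 := by linarith [Real.log_two_gt_d9]
      have h4 : (0 : ℝ) ≤ Nat.log 2 N := by positivity
      nlinarith
    have h5 : 0 ≤ ∑ d ∈ Icc 1 N, ‖g d‖ * (d : ℝ) ^ (-(1 / 3) : ℝ) :=
      sum_nonneg fun d _ => by positivity
    calc _ ≤ x ^ (1 / 3 : ℝ) * (3 * Real.log x) *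
          ∑ d ∈ Icc 1 N, ‖g d‖ * (d : ℝ) ^ (-(1 / 3) : ℝ) := by gcongr
      _ = 3 * x ^ (1 / 3 : ℝ) *
          (Real.log x * ∑ d ∈ Icc 1 N, ‖g d‖ * (d : ℝ) ^ (-(1 / 3) : ℝ)) := by ring
      _ ≤ 3 * x ^ (1 / 3 : ℝ) *
          (C * K * (x ^ (e - 1 / 3) * Real.log x ^ logExponent α θ)) := by gcongr
      _ = 3 * C * K * (x ^ (1 / 3 : ℝ) * x ^ (e - 1 / 3) * Real.log x ^ logExponent α θ) := by ring
      _ = _ := by rw [← Real.rpow_add hx0, add_sub_cancel]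
  have hT4 : 2 * ((N : ℝ) ^ 2 / x) * ∑ d ∈ Icc 1 N, ‖g d‖ * (d : ℝ) ^ (-1 : ℝ) ≤
      4 / (1 - α) * K * E := by
    have hpart := fun n hn hnN => sum_norm_le_mul_rpow hg (L := Real.log x ^ θ) (γ := α)
      hα1.le (N := N)
      (fun n hn hn' => by
        rw [sub_self, Real.rpow_zero, mul_one]
        rw [max_eq_left hN2] at hn'
        have h2 : (n : ℝ) ≤ x := le_trans (by exact_mod_cast hn') hNx
        have hn0 : (0 : ℝ) < n := by exact_mod_cast (by omega : 0 < n)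
        exact Real.rpow_le_rpow (Real.log_natCast_nonneg n) (Real.log_le_log hn0 h2) hθ)
      (n := n) hn hnN
    have hsum := sum_mul_rpow_neg_le (by positivity) hα0 hα1 hpart
    have h1 : (N : ℝ) ^ 2 / x ≤ x ^ e := by
      rw [← he2, Real.rpow_sub_one hx0.ne', two_mul, Real.rpow_add hx0, ← sq]
      gcongr
    calc _ ≤ 2 * x ^ e * (K * (2 * Real.log x ^ θ) * (1 / (1 - α))) := by gcongr
      _ = 4 / (1 - α) * K * (x ^ e * Real.log x ^ θ) := by ring
      _ ≤ _ := by gcongr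
  refine (norm_fracSum_sub_le hfg (summable_fracTerm hθ hα1 hfg hg) hx0 N).trans ?_
  have hfin : (6 / (1 - α) + 602 * (3 * C + 4 / (1 - α))) * K * E = 2 / (1 - α) * K * E +
      4 / (1 - α) * K * E + 602 * (3 * C * K * E + 4 / (1 - α) * K * E) := by ring
  rw [hfin]
  gcongr
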